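/- Let $(\theta_n)_{n\ge1}$ be a null sequence in $(0,1)$ that is regular, i.e. nonincreasing with $\theta_{m+n}\ge\theta_m\theta_n$ for all $m,n\ge1$. Suppose that $\theta=\lim_n\theta_n^{1/n}<1$, set $\varphi_n=\theta_n/\theta^n$, and suppose that $0<\inf_{n\ge1}\varphi_n\le\sup_{n\ge1}\varphi_n<1$. Then the mixed Tsirelson space $T[(\mathcal S_n,\theta_n)_{n=1}^\infty]$ and the modified mixed Tsirelson space $T_M[(\mathcal S_n,\theta_n)_{n=1}^\infty]$ are not isomorphic, i.e. there is no linear homeomorphism of one onto the other. Here $\mathcal S_0$ consists of the singletons in $\mathbb N=\{1,2,\dots\}$ and the empty set, and $\mathcal S_n$ ($n\ge1$) consists of the empty set and all unions $G_1\cup\dots\cup G_k$ of nonempty $G_i\in\mathcal S_{n-1}$ with $G_1<\dots<G_k$ and $k\le\min G_1$, where $A<B$ means $\max A<\min B$. A finite sequence $(E_i)_{i=1}^r$ of nonempty finite subsets of $\mathbb N$ is $\mathcal S_n$-admissible if $E_1<\dots<E_r$ and $\{\min E_i\}_{i=1}^r\in\mathcal S_n$; it is $\mathcal S_n$-allowable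 if the $E_i$ are pairwise disjoint and $\{\min E_i\}_{i=1}^r\in\mathcal S_n$. For a finitely supported real sequence $x\in c_{00}$ and a finite set $E\subset\mathbb N$, $Ex$ is the product of $x$ with the characteristic function of $E$. Let $\|x\|_0=\sup_k|x_k|$ and $$\|x\|_{m+1}=\max\Bigl\{\|x\|_m,\ \sup_{n\ge1}\theta_n\sup\sum_{i=1}^r\|E_ix\|_m\Bigr\},$$ the inner supremum being over all $\mathcal S_n$-admissible sequences $(E_i)_{i=1}^r$. $T[(\mathcal S_n,\theta_n)_{n=1}^\infty]$ is the completion of $c_{00}$ in the norm $\|x\|=\lim_m\|x\|_m$. $T_M[(\mathcal S_n,\theta_n)_{n=1}^\infty]$ is defined in the same way with $\mathcal S_n$-allowable sequences in place of $\mathcal S_n$-admissible ones. -/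

import Mathlib

open Filter Topology

noncomputable section

namespace MixedTsirelson

/-- `c₀₀`: finitely supported real sequences, indexed by the positive integers. -/
abbrev C00 : Type := ℕ+ →₀ ℝ

/-- `A < B` for finite sets of positive integers: every element of `A` lies below every element
of `B` (this holds if `A` or `B` is empty). -/
def Precedes (A B : Finset ℕ+) : Prop := ∀ a ∈ A, ∀ b ∈ B, a < b

/-- The Schreier families. `𝒮₀` consists of the singletons and the empty set; `𝒮ₙ₊₁` consists of
the unions `G₁ ∪ ⋯ ∪ Gₖ` of nonempty sets `G₁ < ⋯ < Gₖ` of `𝒮ₙ` with `k ≤ min G₁` (for `k = 0`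
this is the empty set). As the `Gᵢ` are successive, `k ≤ min G₁` says that `k` is at most every
element of the union. -/
def Schreier : ℕ → Set (Finset ℕ+)
  | 0 => {F | F = ∅ ∨ ∃ k, F = {k}}
  | n + 1 => {F | ∃ (k : ℕ) (G : Fin k → Finset ℕ+),
      (∀ i, (G i).Nonempty ∧ G i ∈ Schreier n) ∧
      (∀ i j, i < j → Precedes (G i) (G j)) ∧
      F = Finset.univ.biUnion G ∧
      ∀ a ∈ F, k ≤ (a : ℕ)}

/-- The minima of the sets `E₁, …, Eᵣ`, all assumed nonempty, form a set of `𝒮ₙ`. -/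
def MinimaInSchreier (n : ℕ) {r : ℕ} (E : Fin r → Finset ℕ+) : Prop :=
  ∃ h : ∀ i, (E i).Nonempty, Finset.univ.image (fun i => (E i).min' (h i)) ∈ Schreier n

/-- `𝒮ₙ`-admissible sequences of (nonempty) finite sets: `E₁ < ⋯ < Eᵣ` and
`{min E₁, …, min Eᵣ} ∈ 𝒮ₙ`. -/
def Admissible (n r : ℕ) (E : Fin r → Finset ℕ+) : Prop :=
  (∀ i j, i < j → Precedes (E i) (E j)) ∧ MinimaInSchreier n E

/-- `𝒮ₙ`-allowable sequences of (nonempty) finite sets: the `Eᵢ` are pairwise disjoint and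
`{min E₁, …, min Eᵣ} ∈ 𝒮ₙ`. -/
def Allowable (n r : ℕ) (E : Fin r → Finset ℕ+) : Prop :=
  (∀ i j, i ≠ j → Disjoint (E i) (E j)) ∧ MinimaInSchreier n E

/-- `E x`: the coordinatewise product of `x` with the characteristic function of `E`. -/
def restrict (E : Finset ℕ+) (x : C00) : C00 := x.filter (· ∈ E)

/-- The `ℓ¹`-norm on `c₀₀`. -/
def l1 (x : C00) : ℝ := ∑ k ∈ x.support, |x k|

/-- The norms `‖·‖ₘ` on `c₀₀`, for a class `P n r` of sequences `(E₁, …, Eᵣ)` (to be taken as the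
`𝒮ₙ`-admissible or the `𝒮ₙ`-allowable ones): `‖x‖₀` is the sup norm and
`‖x‖ₘ₊₁ = max {‖x‖ₘ, sup θₙ ∑ᵢ ‖Eᵢ x‖ₘ}`, the supremum being over all `n ≥ 1` and all sequences
of the class for this `n`. -/
def iterNorm (P : ℕ → ∀ r : ℕ, (Fin r → Finset ℕ+) → Prop) (θ : ℕ+ → ℝ) : ℕ → C00 → ℝ
  | 0, x => ⨆ k, |x k|
  | m + 1, x => max (iterNorm P θ m x)
      (sSup {s | ∃ (n : ℕ+) (r : ℕ) (E : Fin r → Finset ℕ+), P n r E ∧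
        s = θ n * ∑ i, iterNorm P θ m (restrict (E i) x)})

/-- The limit of the nondecreasing sequence `‖x‖ₘ`; see `tendsto_iterNorm`. -/
def limNorm (P : ℕ → ∀ r : ℕ, (Fin r → Finset ℕ+) → Prop) (θ : ℕ+ → ℝ) (x : C00) : ℝ :=
  ⨆ m, iterNorm P θ m x

/-- The two classes that matter consist of sequences of pairwise disjoint sets. -/
def PairwiseDisj (P : ℕ → ∀ r : ℕ, (Fin r → Finset ℕ+) → Prop) : Prop :=
  ∀ n r E, P n r E → ∀ i j, i ≠ j → Disjoint (E i) (E j)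

theorem pairwiseDisj_admissible : PairwiseDisj Admissible := by
  intro n r E hE i j hij
  rw [Finset.disjoint_left]
  intro a hi hj
  rcases lt_or_gt_of_ne hij with h | h
  · exact lt_irrefl _ (hE.1 i j h a hi a hj)
  · exact lt_irrefl _ (hE.1 j i h a hj a hi)

theorem pairwiseDisj_allowable : PairwiseDisj Allowable := fun _ _ _ hE => hE.1

theorem l1_nonneg (x : C00) : 0 ≤ l1 x := Finset.sum_nonneg fun _ _ => abs_nonneg _

theorem l1_restrict (E : Finset ℕ+) (x : C00) :
    l1 (restrict E x) = ∑ k ∈ x.support, if k ∈ E then |x k| else 0 := by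
  classical
  rw [l1, restrict, Finsupp.support_filter, Finset.sum_filter]
  refine Finset.sum_congr rfl fun k _ => ?_
  by_cases h : k ∈ E <;> simp [h]

theorem sum_l1_restrict_le {r : ℕ} (E : Fin r → Finset ℕ+)
    (hE : ∀ i j, i ≠ j → Disjoint (E i) (E j)) (x : C00) :
    ∑ i, l1 (restrict (E i) x) ≤ l1 x := by
  classical
  simp only [l1_restrict]
  rw [Finset.sum_comm, l1]
  refine Finset.sum_le_sum fun k _ => ?_
  by_cases h : ∃ i, k ∈ E i
  · obtain ⟨i, hi⟩ := h
    rw [Finset.sum_eq_single i]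
    · simp [hi]
    · intro j _ hji
      rw [if_neg]
      exact fun hj => Finset.disjoint_left.1 (hE j i hji) hj hi
    · simp
  · push Not at h
    simp [h]

theorem bddAbove_abs (x : C00) : BddAbove (Set.range fun k => |x k|) := by
  refine ⟨l1 x, ?_⟩
  rintro _ ⟨k, rfl⟩
  by_cases hk : k ∈ x.support
  · exact Finset.single_le_sum (f := fun k => |x k|) (fun _ _ => abs_nonneg _) hk
  · simpa [Finsupp.notMem_support_iff.1 hk] using l1_nonneg x

section
variable {P : ℕ → ∀ r : ℕ, (Fin r → Finset ℕ+) → Prop} {θ : ℕ+ → ℝ}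

theorem iterNorm_mono_succ (m : ℕ) (x : C00) : iterNorm P θ m x ≤ iterNorm P θ (m + 1) x :=
  le_max_left _ _

theorem iterNorm_monotone (x : C00) : Monotone fun m => iterNorm P θ m x :=
  monotone_nat_of_le_succ fun m => iterNorm_mono_succ m x

theorem abs_le_iterNorm (m : ℕ) (x : C00) (k : ℕ+) : |x k| ≤ iterNorm P θ m x :=
  (le_ciSup (bddAbove_abs x) k).trans (iterNorm_monotone x (Nat.zero_le m))

theorem iterNorm_nonneg (m : ℕ) (x : C00) : 0 ≤ iterNorm P θ m x :=
  (abs_nonneg _).trans (abs_le_iterNorm m x 1)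

theorem iterNorm_le_l1 (hP : PairwiseDisj P) (hθ : ∀ n, θ n ∈ Set.Ioo (0 : ℝ) 1) (m : ℕ) :
    ∀ x : C00, iterNorm P θ m x ≤ l1 x := by
  induction m with
  | zero =>
    intro x
    refine ciSup_le fun k => ?_
    by_cases hk : k ∈ x.support
    · exact Finset.single_le_sum (f := fun k => |x k|) (fun _ _ => abs_nonneg _) hk
    · simpa [Finsupp.notMem_support_iff.1 hk] using l1_nonneg x
  | succ m ih =>
    intro x
    refine max_le (ih x) (Real.sSup_le ?_ (l1_nonneg x))
    rintro _ ⟨n, r, E, hE, rfl⟩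
    have h0 : 0 ≤ ∑ i, iterNorm P θ m (restrict (E i) x) :=
      Finset.sum_nonneg fun _ _ => iterNorm_nonneg m _
    calc θ n * ∑ i, iterNorm P θ m (restrict (E i) x)
        ≤ 1 * ∑ i, iterNorm P θ m (restrict (E i) x) :=
          mul_le_mul_of_nonneg_right (hθ n).2.le h0
      _ = ∑ i, iterNorm P θ m (restrict (E i) x) := one_mul _
      _ ≤ ∑ i, l1 (restrict (E i) x) := Finset.sum_le_sum fun i _ => ih _
      _ ≤ l1 x := sum_l1_restrict_le E (hP n r E hE) x

theorem le_iterNorm_succ (hP : PairwiseDisj P) (hθ : ∀ n, θ n ∈ Set.Ioo (0 : ℝ) 1) (m : ℕ)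
    (x : C00) (n : ℕ+) (r : ℕ) (E : Fin r → Finset ℕ+) (hE : P n r E) :
    θ n * ∑ i, iterNorm P θ m (restrict (E i) x) ≤ iterNorm P θ (m + 1) x := by
  have hb : BddAbove {s | ∃ (n : ℕ+) (r : ℕ) (E : Fin r → Finset ℕ+), P n r E ∧
      s = θ n * ∑ i, iterNorm P θ m (restrict (E i) x)} := by
    refine ⟨l1 x, ?_⟩
    rintro _ ⟨n, r, E, hE, rfl⟩
    have h0 : 0 ≤ ∑ i, iterNorm P θ m (restrict (E i) x) :=
      Finset.sum_nonneg fun _ _ => iterNorm_nonneg m _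
    refine (mul_le_of_le_one_left h0 (hθ n).2.le).trans ?_
    exact (Finset.sum_le_sum fun i _ => iterNorm_le_l1 hP hθ m _).trans
      (sum_l1_restrict_le E (hP n r E hE) x)
  exact (le_csSup hb ⟨n, r, E, hE, rfl⟩).trans (le_max_right _ _)

theorem iterNorm_add_le (hP : PairwiseDisj P) (hθ : ∀ n, θ n ∈ Set.Ioo (0 : ℝ) 1) (m : ℕ) :
    ∀ x y : C00, iterNorm P θ m (x + y) ≤ iterNorm P θ m x + iterNorm P θ m y := by
  induction m with
  | zero =>
    intro x y
    exact ciSup_le fun k => (abs_add_le _ _).trans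
      (add_le_add (le_ciSup (bddAbove_abs x) k) (le_ciSup (bddAbove_abs y) k))
  | succ m ih =>
    intro x y
    refine max_le ((ih x y).trans
      (add_le_add (iterNorm_mono_succ m x) (iterNorm_mono_succ m y)))
      (Real.sSup_le ?_ (add_nonneg (iterNorm_nonneg _ x) (iterNorm_nonneg _ y)))
    rintro _ ⟨n, r, E, hE, rfl⟩
    refine le_trans ?_ (add_le_add (le_iterNorm_succ hP hθ m x n r E hE)
      (le_iterNorm_succ hP hθ m y n r E hE))
    rw [← mul_add, ← Finset.sum_add_distrib]
    refine mul_le_mul_of_nonneg_left (Finset.sum_le_sum fun i _ => ?_) (hθ n).1.le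
    simpa only [restrict, Finsupp.filter_add] using ih (restrict (E i) x) (restrict (E i) y)

theorem iterNorm_smul_le (hP : PairwiseDisj P) (hθ : ∀ n, θ n ∈ Set.Ioo (0 : ℝ) 1) (c : ℝ)
    (m : ℕ) : ∀ x : C00, iterNorm P θ m (c • x) ≤ |c| * iterNorm P θ m x := by
  induction m with
  | zero =>
    intro x
    refine ciSup_le fun k => ?_
    rw [Finsupp.smul_apply, smul_eq_mul, abs_mul]
    exact mul_le_mul_of_nonneg_left (le_ciSup (bddAbove_abs x) k) (abs_nonneg c)
  | succ m ih =>
    intro x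
    refine max_le ((ih x).trans
      (mul_le_mul_of_nonneg_left (iterNorm_mono_succ m x) (abs_nonneg c)))
      (Real.sSup_le ?_ (mul_nonneg (abs_nonneg c) (iterNorm_nonneg _ x)))
    rintro _ ⟨n, r, E, hE, rfl⟩
    refine le_trans ?_ (mul_le_mul_of_nonneg_left (le_iterNorm_succ hP hθ m x n r E hE)
      (abs_nonneg c))
    rw [mul_left_comm, Finset.mul_sum Finset.univ _ |c|]
    refine mul_le_mul_of_nonneg_left (Finset.sum_le_sum fun i _ => ?_) (hθ n).1.le
    simpa only [restrict, Finsupp.filter_smul] using ih (restrict (E i) x)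

theorem bddAbove_iterNorm (hP : PairwiseDisj P) (hθ : ∀ n, θ n ∈ Set.Ioo (0 : ℝ) 1) (x : C00) :
    BddAbove (Set.range fun m => iterNorm P θ m x) :=
  ⟨l1 x, by rintro _ ⟨m, rfl⟩; exact iterNorm_le_l1 hP hθ m x⟩

theorem tendsto_iterNorm (hP : PairwiseDisj P) (hθ : ∀ n, θ n ∈ Set.Ioo (0 : ℝ) 1) (x : C00) :
    Tendsto (fun m => iterNorm P θ m x) atTop (𝓝 (limNorm P θ x)) :=
  tendsto_atTop_ciSup (iterNorm_monotone x) (bddAbove_iterNorm hP hθ x)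

theorem limNorm_smul_le (hP : PairwiseDisj P) (hθ : ∀ n, θ n ∈ Set.Ioo (0 : ℝ) 1) (c : ℝ)
    (x : C00) : limNorm P θ (c • x) ≤ |c| * limNorm P θ x :=
  ciSup_le fun m => (iterNorm_smul_le hP hθ c m x).trans
    (mul_le_mul_of_nonneg_left (le_ciSup (bddAbove_iterNorm hP hθ x) m) (abs_nonneg c))

end

/-- The vector space `c₀₀`, to be given the norm `limNorm P θ`. -/
def PreSpace (P : ℕ → ∀ r : ℕ, (Fin r → Finset ℕ+) → Prop) (θ : ℕ+ → ℝ)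
    (_hP : PairwiseDisj P) (_hθ : ∀ n, θ n ∈ Set.Ioo (0 : ℝ) 1) : Type := C00

section
variable (P : ℕ → ∀ r : ℕ, (Fin r → Finset ℕ+) → Prop) (θ : ℕ+ → ℝ)
  (hP : PairwiseDisj P) (hθ : ∀ n, θ n ∈ Set.Ioo (0 : ℝ) 1)

instance : AddCommGroup (PreSpace P θ hP hθ) := inferInstanceAs (AddCommGroup C00)

instance : Module ℝ (PreSpace P θ hP hθ) := inferInstanceAs (Module ℝ C00)

instance : Norm (PreSpace P θ hP hθ) := ⟨fun x => limNorm P θ (show C00 from x)⟩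

theorem preSpace_core : NormedSpace.Core ℝ (PreSpace P θ hP hθ) where
  norm_nonneg x := Real.iSup_nonneg fun m => iterNorm_nonneg m _
  norm_smul c x := by
    change limNorm P θ (c • (show C00 from x)) = |c| * limNorm P θ (show C00 from x)
    refine le_antisymm (limNorm_smul_le hP hθ c _) ?_
    rcases eq_or_ne c 0 with rfl | hc
    · rw [abs_zero, zero_mul]
      exact Real.iSup_nonneg fun m => iterNorm_nonneg m _
    · have h := limNorm_smul_le hP hθ c⁻¹ (c • (show C00 from x))
      rw [inv_smul_smul₀ hc, abs_inv] at h
      rwa [← le_inv_mul_iff₀ (abs_pos.2 hc)]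
  norm_triangle x y := ciSup_le fun m => (iterNorm_add_le hP hθ m _ _).trans
    (add_le_add (le_ciSup (bddAbove_iterNorm hP hθ _) m)
      (le_ciSup (bddAbove_iterNorm hP hθ _) m))
  norm_eq_zero_iff x := by
    constructor
    · intro h
      refine Finsupp.ext fun k => abs_nonpos_iff.1 ?_
      have h1 : limNorm P θ (show C00 from x) = 0 := h
      rw [← h1]
      exact (abs_le_iterNorm 0 _ k).trans (le_ciSup (bddAbove_iterNorm hP hθ _) 0)
    · rintro rfl
      have h := limNorm_smul_le hP hθ 0 (0 : C00)
      rw [abs_zero, zero_mul, smul_zero] at h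
      exact le_antisymm h (Real.iSup_nonneg fun m => iterNorm_nonneg m _)

instance : NormedAddCommGroup (PreSpace P θ hP hθ) :=
  NormedAddCommGroup.ofCore (preSpace_core P θ hP hθ)

instance : NormedSpace ℝ (PreSpace P θ hP hθ) := NormedSpace.ofCore (preSpace_core P θ hP hθ)

end

/-- The mixed Tsirelson space `T[(𝒮ₙ, θₙ)_{n ≥ 1}]`: the completion of `c₀₀` for the norm built
from admissible sequences. -/
abbrev T (θ : ℕ+ → ℝ) (hθ : ∀ n, θ n ∈ Set.Ioo (0 : ℝ) 1) : Type :=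
  UniformSpace.Completion (PreSpace Admissible θ pairwiseDisj_admissible hθ)

/-- The modified mixed Tsirelson space `T_M[(𝒮ₙ, θₙ)_{n ≥ 1}]`: the completion of `c₀₀` for the
norm built from allowable sequences. -/
abbrev TM (θ : ℕ+ → ℝ) (hθ : ∀ n, θ n ∈ Set.Ioo (0 : ℝ) 1) : Type :=
  UniformSpace.Completion (PreSpace Allowable θ pairwiseDisj_allowable hθ)

/-- Regular sequences: nonincreasing and supermultiplicative. -/
structure IsRegular (θ : ℕ+ → ℝ) : Prop where
  antitone : Antitone θ
  supermul : ∀ m n, θ m * θ n ≤ θ (m + n)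

end MixedTsirelson

end

noncomputable section

namespace MixedTsirelson

/-! The two norms are separated by trees. Number the nodes of a finite tree in pre-order, let node
`v` have `M v` children with `M` growing fast, let `yᵢ` be the average of the unit vectors over
level `i`, and put `x = ∑_{i ≤ R} ϑ⁻ⁱ yᵢ`.

In the modified space, level `i` is a set of `𝒮ᵢ` and `θᵢ ϑ⁻ⁱ ≥ c`, so each level `i ≥ 1` has norm
at least `c`. The levels interlace but are disjoint, so they form an `𝒮₁`-allowable family, and the
norm of `x` grows like `θ₁ c R` (`le_limNorm_sum_coef`).

In the unmodified space, `x` stays bounded as `R` grows (`limNorm_testVec_le`). Successive sets have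
disjoint convex hulls, and in pre-order a hull cannot single out one level: if it meets the subtree
of a node that it omits, then its minimum lies in that subtree. So its share of a deeper level is at
most its share of a higher one, up to the subtrees containing the minimum (`mass_hull_le`). Over an
admissible family these minima combine into Schreier sets, which hit few subtrees at deeper levels
(`hitFrac_le`). Up to this error, one application of `θₙ ≤ d ϑⁿ` turns a bound `b` into `d ((1 -
ϑ)⁻¹ + b)`, which is at most `b` for a suitable `b` because `d < 1` (`mul_sum_normBound_le`).

An isomorphism from the unmodified space to the modified one sends sparse differences `e_a - e_b`
close to successive vectors `w_j` bounded below (`exists_successive_approx`). The lower estimate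
applies to tree combinations of the `w_j`, the upper one to those of `e_a` and of `e_b`; for large
`R` they conflict. -/

/-! ### Schreier families and their composition. -/

theorem empty_mem_schreier (n : ℕ) : (∅ : Finset ℕ+) ∈ Schreier n := by
  cases n with
  | zero => exact Or.inl rfl
  | succ n => exact ⟨0, fun _ => ∅, fun i => i.elim0, fun i => i.elim0, by simp, by simp⟩

/-- In the definition of `𝒮ₙ₊₁` some of the sets may be empty. -/
theorem biUnion_mem_schreier_succ {n k : ℕ} (G : Fin k → Finset ℕ+)
    (hG : ∀ i, G i ∈ Schreier n) (hlt : ∀ i j, i < j → Precedes (G i) (G j))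
    (hk : ∀ i, ∀ a ∈ G i, k ≤ (a : ℕ)) : Finset.univ.biUnion G ∈ Schreier (n + 1) := by
  classical
  set s : Finset (Fin k) := Finset.univ.filter fun i => (G i).Nonempty
  have hmem : ∀ i, s.orderEmbOfFin rfl i ∈ s := fun i => s.orderEmbOfFin_mem rfl i
  refine ⟨s.card, fun i => G (s.orderEmbOfFin rfl i), fun i => ⟨?_, hG _⟩,
    fun i j hij => hlt _ _ ((s.orderEmbOfFin rfl).strictMono hij), ?_, ?_⟩
  · exact (Finset.mem_filter.1 (hmem i)).2
  · ext a
    simp only [Finset.mem_biUnion, Finset.mem_univ, true_and]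
    constructor
    · rintro ⟨i, hi⟩
      have his : i ∈ s := by
        exact Finset.mem_filter.2 ⟨Finset.mem_univ _, ⟨a, hi⟩⟩
      have : i ∈ Set.range (s.orderEmbOfFin rfl) := by
        rw [Finset.range_orderEmbOfFin]; exact his
      obtain ⟨j, rfl⟩ := this
      exact ⟨j, hi⟩
    · rintro ⟨i, hi⟩
      exact ⟨_, hi⟩
  · intro a ha
    obtain ⟨i, -, hi⟩ := Finset.mem_biUnion.1 ha
    refine le_trans ?_ (hk i a hi)
    simpa using s.card_le_univ

theorem singleton_mem_schreier (n : ℕ) (a : ℕ+) : ({a} : Finset ℕ+) ∈ Schreier n := by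
  induction n with
  | zero => exact Or.inr ⟨a, rfl⟩
  | succ n ih =>
    have := biUnion_mem_schreier_succ (k := 1) (fun _ => {a}) (fun _ => ih)
      (fun i j h => absurd h (by omega)) (by
        intro i b hb
        exact b.pos)
    simpa using this

/-- `𝒮ₙ[𝒮ₖ] ⊆ 𝒮ₖ₊ₙ`, with the minima allowed to move to the right. -/
theorem schreier_biUnion {k : ℕ} (n : ℕ) : ∀ F ∈ Schreier n, ∀ G : ℕ+ → Finset ℕ+,
    (∀ a ∈ F, G a ∈ Schreier k) → (∀ a ∈ F, ∀ b ∈ G a, a ≤ b) →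
    (∀ a ∈ F, ∀ b ∈ F, a < b → Precedes (G a) (G b)) → F.biUnion G ∈ Schreier (k + n) := by
  induction n with
  | zero =>
    rintro F (rfl | ⟨a, rfl⟩) G hG - -
    · simpa using empty_mem_schreier k
    · simpa using hG a (by simp)
  | succ n ih =>
    rintro F ⟨q, H, hH, hlt, rfl, hq⟩ G hG hle hprec
    have hsub : ∀ i, ∀ a ∈ H i, a ∈ Finset.univ.biUnion H := fun i a ha =>
      Finset.mem_biUnion.2 ⟨i, Finset.mem_univ _, ha⟩
    rw [Finset.biUnion_biUnion]
    refine biUnion_mem_schreier_succ (n := k + n) (fun i => (H i).biUnion G) (fun i => ?_) ?_ ?_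
    · exact ih (H i) (hH i).2 G (fun a ha => hG a (hsub i a ha))
        (fun a ha => hle a (hsub i a ha))
        (fun a ha b hb => hprec a (hsub i a ha) b (hsub i b hb))
    · intro i j hij x hx y hy
      obtain ⟨a, ha, hxa⟩ := Finset.mem_biUnion.1 hx
      obtain ⟨b, hb, hyb⟩ := Finset.mem_biUnion.1 hy
      exact hprec a (hsub i a ha) b (hsub j b hb) (hlt i j hij a ha b hb) x hxa y hyb
    · intro i x hx
      obtain ⟨a, ha, hxa⟩ := Finset.mem_biUnion.1 hx
      exact (hq a (hsub i a ha)).trans (hle a (hsub i a ha) x hxa)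

/-- If `E₁ < ⋯ < Eᵣ` is `𝒮ₙ`-admissible and `G₁ < ⋯ < Gᵣ` are in `𝒮ₖ` with `min Eᵢ ≤ Gᵢ`,
then `G₁ ∪ ⋯ ∪ Gᵣ ∈ 𝒮ₖ₊ₙ`. -/
theorem Admissible.biUnion_mem {n k r : ℕ} {E : Fin r → Finset ℕ+} (hE : Admissible n r E)
    (G : Fin r → Finset ℕ+) (hG : ∀ i, G i ∈ Schreier k)
    (hle : ∀ i, ∀ b ∈ G i, ∃ a ∈ E i, a ≤ b)
    (hprec : ∀ i j, i < j → Precedes (G i) (G j)) :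
    Finset.univ.biUnion G ∈ Schreier (k + n) := by
  classical
  obtain ⟨hlt, hne, hF⟩ := hE
  set f : Fin r → ℕ+ := fun i => (E i).min' (hne i) with hf
  have hmono : StrictMono f := fun i j hij =>
    hlt i j hij _ (Finset.min'_mem _ _) _ (Finset.min'_mem _ _)
  have hG' : ∀ i, (Finset.univ.filter fun j => f j = f i).biUnion G = G i := by
    intro i
    have : (Finset.univ.filter fun j => f j = f i) = {i} := by
      ext j
      simp [hmono.injective.eq_iff]
    rw [this, Finset.singleton_biUnion]
  have := schreier_biUnion (k := k) n _ hF
    (fun a => (Finset.univ.filter fun j => f j = a).biUnion G) ?_ ?_ ?_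
  · rw [Finset.image_biUnion] at this
    simpa only [hG'] using this
  · intro a ha
    obtain ⟨i, -, rfl⟩ := Finset.mem_image.1 ha
    rw [hG']; exact hG i
  · intro a ha b hb
    obtain ⟨i, -, rfl⟩ := Finset.mem_image.1 ha
    rw [hG'] at hb
    obtain ⟨c, hc, hcb⟩ := hle i b hb
    exact (Finset.min'_le _ _ hc).trans hcb
  · intro a ha b hb hab
    obtain ⟨i, -, rfl⟩ := Finset.mem_image.1 ha
    obtain ⟨j, -, rfl⟩ := Finset.mem_image.1 hb
    rw [hG', hG']
    exact hprec i j (hmono.lt_iff_lt.1 hab)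

/-! ### Trees in pre-order, level averages, and masses of convex hulls. -/

section

/-- The tree of height `h` with root `u` in which the node `v` has `M v` children, listed in
pre-order, occupies the integers in `[u, treeEnd M h u)`. -/
def treeEnd (M : ℕ → ℕ) : ℕ → ℕ → ℕ
  | 0, u => u + 1
  | h + 1, u => (treeEnd M h)^[M u] (u + 1)

/-- The child number `s` of the root `u` of a tree of height `h + 1`. -/
def child (M : ℕ → ℕ) (h u s : ℕ) : ℕ := (treeEnd M h)^[s] (u + 1)

/-- The average of `F` over the nodes of level `i` of the tree of height `h` with root `u`; here
`F h' v` may depend on the subtree of height `h'` with root `v`. -/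
def levelAvg (M : ℕ → ℕ) (F : ℕ → ℕ → ℝ) : ℕ → ℕ → ℕ → ℝ
  | 0, h, u => F h u
  | _ + 1, 0, _ => 0
  | i + 1, h + 1, u => (∑ s ∈ Finset.range (M u), levelAvg M F i h (child M h u s)) / M u

variable {M : ℕ → ℕ}

theorem child_succ (h u s : ℕ) : child M h u (s + 1) = treeEnd M h (child M h u s) :=
  Function.iterate_succ_apply' _ _ _

theorem treeEnd_succ (h u : ℕ) : treeEnd M (h + 1) u = child M h u (M u) := rfl

theorem lt_treeEnd (h : ℕ) : ∀ u, u < treeEnd M h u := by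
  induction h with
  | zero => intro u; exact Nat.lt_succ_self u
  | succ h ih =>
    intro u
    have : ∀ s, u < child M h u s := by
      intro s
      induction s with
      | zero => exact Nat.lt_succ_self u
      | succ s hs => rw [child_succ]; exact hs.trans (ih _)
    exact this _

theorem child_strictMono (h u : ℕ) : StrictMono (child M h u) :=
  strictMono_nat_of_lt_succ fun s => by rw [child_succ]; exact lt_treeEnd h _

theorem lt_child (h u s : ℕ) : u < child M h u s :=
  (Nat.lt_succ_self u).trans_le ((child_strictMono h u).monotone (Nat.zero_le s))

theorem treeEnd_child_le (h u : ℕ) {s : ℕ} (hs : s < M u) :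
    treeEnd M h (child M h u s) ≤ treeEnd M (h + 1) u := by
  rw [← child_succ, treeEnd_succ]
  exact (child_strictMono h u).monotone hs

theorem levelAvg_le_of_subtree {F G : ℕ → ℕ → ℝ} (i : ℕ) : ∀ h u,
    (∀ h' v, u ≤ v → treeEnd M h' v ≤ treeEnd M h u → F h' v ≤ G h' v) →
    levelAvg M F i h u ≤ levelAvg M G i h u := by
  induction i with
  | zero => exact fun h u H => H h u le_rfl le_rfl
  | succ i ih =>
    intro h u H
    cases h with
    | zero => exact le_rfl
    | succ h =>
      refine div_le_div_of_nonneg_right (Finset.sum_le_sum fun s hs => ih _ _ fun h' v h1 h2 => ?_)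
        (Nat.cast_nonneg _)
      exact H h' v ((lt_child h u s).le.trans h1)
        (h2.trans (treeEnd_child_le h u (Finset.mem_range.1 hs)))

theorem levelAvg_mono {F G : ℕ → ℕ → ℝ} (H : ∀ h u, F h u ≤ G h u) (i h u : ℕ) :
    levelAvg M F i h u ≤ levelAvg M G i h u :=
  levelAvg_le_of_subtree i h u fun h' v _ _ => H h' v

theorem levelAvg_sum {ι : Type*} (s : Finset ι) (F : ι → ℕ → ℕ → ℝ) (i : ℕ) : ∀ h u,
    levelAvg M (fun h u => ∑ l ∈ s, F l h u) i h u = ∑ l ∈ s, levelAvg M (F l) i h u := by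
  induction i with
  | zero => exact fun h u => rfl
  | succ i ih =>
    intro h u
    cases h with
    | zero => simp [levelAvg]
    | succ h =>
      simp only [levelAvg, ih]
      rw [Finset.sum_comm, Finset.sum_div]

theorem levelAvg_add (F G : ℕ → ℕ → ℝ) (i h u : ℕ) :
    levelAvg M (fun h u => F h u + G h u) i h u = levelAvg M F i h u + levelAvg M G i h u := by
  simpa using levelAvg_sum (M := M) (Finset.univ : Finset Bool) (fun b => cond b F G) i h u

theorem levelAvg_const_mul (c : ℝ) (F : ℕ → ℕ → ℝ) (i : ℕ) : ∀ h u,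
    levelAvg M (fun h u => c * F h u) i h u = c * levelAvg M F i h u := by
  induction i with
  | zero => exact fun h u => rfl
  | succ i ih =>
    intro h u
    cases h with
    | zero => simp [levelAvg]
    | succ h => simp only [levelAvg, ih, ← Finset.mul_sum, mul_div_assoc]

/-- This localises a comparison of levels `i` and `i + j` to the single subtrees rooted at level
`i`. -/
theorem levelAvg_levelAvg (F : ℕ → ℕ → ℝ) (i j : ℕ) : ∀ h u,
    levelAvg M (levelAvg M F j) i h u = levelAvg M F (i + j) h u := by
  induction i with
  | zero => intro h u; rw [Nat.zero_add]; rfl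
  | succ i ih =>
    intro h u
    rw [Nat.succ_add]
    cases h with
    | zero => rfl
    | succ h => simp only [levelAvg, ih]

theorem levelAvg_eq_zero_of_lt (F : ℕ → ℕ → ℝ) (i : ℕ) : ∀ h u, h < i →
    levelAvg M F i h u = 0 := by
  induction i with
  | zero => intro h u hi; omega
  | succ i ih =>
    intro h u hi
    cases h with
    | zero => rfl
    | succ h =>
      simp only [levelAvg]
      rw [Finset.sum_eq_zero fun s _ => ih h _ (by omega), zero_div]

theorem levelAvg_zero (i h u : ℕ) : levelAvg M (fun _ _ => 0) i h u = 0 := by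
  simpa using levelAvg_const_mul (M := M) 0 (fun _ _ => 0) i h u

theorem levelAvg_nonneg {F : ℕ → ℕ → ℝ} (H : ∀ h u, 0 ≤ F h u) (i h u : ℕ) :
    0 ≤ levelAvg M F i h u :=
  (levelAvg_zero i h u).symm.le.trans (levelAvg_mono H i h u)

theorem levelAvg_one (hM : ∀ u, 0 < M u) (i : ℕ) : ∀ h u, i ≤ h →
    levelAvg M (fun _ _ => 1) i h u = 1 := by
  induction i with
  | zero => exact fun h u _ => rfl
  | succ i ih =>
    intro h u hi
    cases h with
    | zero => omega
    | succ h =>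
      simp only [levelAvg]
      rw [Finset.sum_congr rfl fun s _ => ih h _ (by omega)]
      have : (M u : ℝ) ≠ 0 := Nat.cast_ne_zero.2 (hM u).ne'
      simp [this]

theorem levelAvg_le_one (hM : ∀ u, 0 < M u) {F : ℕ → ℕ → ℝ} (H : ∀ h u, F h u ≤ 1)
    (i h u : ℕ) : levelAvg M F i h u ≤ 1 := by
  rcases le_or_gt i h with hi | hi
  · exact (levelAvg_mono H i h u).trans (levelAvg_one hM i h u hi).le
  · rw [levelAvg_eq_zero_of_lt F i h u hi]; exact zero_le_one

/-- The mass that the average of level `i` gives to the set `A`. -/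
def mass (M : ℕ → ℕ) (A : Finset ℕ) (i h u : ℕ) : ℝ :=
  levelAvg M (fun _ v => if v ∈ A then 1 else 0) i h u

theorem mass_nonneg (A : Finset ℕ) (i h u : ℕ) : 0 ≤ mass M A i h u :=
  levelAvg_nonneg (fun _ _ => by positivity) i h u

theorem mass_le_one (hM : ∀ u, 0 < M u) (A : Finset ℕ) (i h u : ℕ) : mass M A i h u ≤ 1 :=
  levelAvg_le_one hM (fun _ _ => by split_ifs <;> norm_num) i h u

theorem mass_mono {A B : Finset ℕ} (h : A ⊆ B) (i k u : ℕ) : mass M A i k u ≤ mass M B i k u := by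
  refine levelAvg_mono (fun _ v => ?_) i k u
  by_cases hv : v ∈ A
  · rw [if_pos hv, if_pos (h hv)]
  · rw [if_neg hv]; positivity

theorem mass_eq_zero_of_lt (A : Finset ℕ) {i h : ℕ} (u : ℕ) (hi : h < i) : mass M A i h u = 0 :=
  levelAvg_eq_zero_of_lt _ i h u hi

theorem sum_indicator_le {ι : Type*} [Fintype ι] (A : ι → Finset ℕ) (B : Finset ℕ)
    (hd : ∀ i j, i ≠ j → Disjoint (A i) (A j)) (hB : ∀ i, A i ⊆ B) (v : ℕ) :
    (∑ l, if v ∈ A l then (1 : ℝ) else 0) ≤ if v ∈ B then 1 else 0 := by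
  classical
  by_cases h : ∃ l, v ∈ A l
  · obtain ⟨l, hl⟩ := h
    rw [Finset.sum_eq_single l, if_pos hl, if_pos (hB l hl)]
    · intro j _ hj
      rw [if_neg]
      exact fun hj' => Finset.disjoint_left.1 (hd j l hj) hj' hl
    · simp
  · push Not at h
    simp only [h, if_false, Finset.sum_const_zero]
    positivity

theorem sum_mass_le {ι : Type*} [Fintype ι] (A : ι → Finset ℕ) (B : Finset ℕ)
    (hd : ∀ i j, i ≠ j → Disjoint (A i) (A j)) (hB : ∀ i, A i ⊆ B) (i h u : ℕ) :
    ∑ l, mass M (A l) i h u ≤ mass M B i h u := by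
  simp only [mass]
  rw [← levelAvg_sum]
  exact levelAvg_mono (fun _ v => sum_indicator_le A B hd hB v) i h u

theorem mass_eq_zero {A : Finset ℕ} {h u : ℕ} (hA : ∀ z ∈ A, u ≤ z → treeEnd M h u ≤ z) (i : ℕ) :
    mass M A i h u = 0 := by
  refine le_antisymm ?_ (mass_nonneg A i h u)
  rw [← levelAvg_zero (M := M) i h u]
  refine levelAvg_le_of_subtree i h u fun h' v h1 h2 => ?_
  rw [if_neg]
  intro hv
  have := hA v hv h1
  have := lt_treeEnd (M := M) h' v
  omega

/-- The order-convex hull. -/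
def hull (A : Finset ℕ) : Finset ℕ := A.biUnion fun a => A.biUnion fun b => Finset.Icc a b

theorem mem_hull {A : Finset ℕ} {z : ℕ} : z ∈ hull A ↔ ∃ a ∈ A, ∃ b ∈ A, a ≤ z ∧ z ≤ b := by
  simp [hull]

theorem subset_hull (A : Finset ℕ) : A ⊆ hull A := fun a ha =>
  mem_hull.2 ⟨a, ha, a, ha, le_rfl, le_rfl⟩

theorem hull_mono {A B : Finset ℕ} (h : A ⊆ B) : hull A ⊆ hull B := fun z hz => by
  obtain ⟨a, ha, b, hb, h1⟩ := mem_hull.1 hz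
  exact mem_hull.2 ⟨a, h ha, b, h hb, h1⟩

/-- The set `G` meets the tree of height `h` with root `u`, when the node `z` is put at `K z`. -/
def Hits (M : ℕ → ℕ) (K : ℕ → ℕ+) (G : Finset ℕ+) (h u : ℕ) : Prop :=
  ∃ z, u ≤ z ∧ z < treeEnd M h u ∧ K z ∈ G

open Classical in
/-- Total mass that `A` has in the first `R + 1` levels of those trees rooted at level `i` which
`G` hits. -/
def hitMass (M : ℕ → ℕ) (K : ℕ → ℕ+) (R : ℕ) (A : Finset ℕ) (G : Finset ℕ+) (i h u : ℕ) : ℝ :=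
  levelAvg M (fun h' v => if Hits M K G h' v then
    ∑ j ∈ Finset.range (R + 1), mass M (hull A) j h' v else 0) i h u

variable {K : ℕ → ℕ+}

theorem sum_mass_range_nonneg (R : ℕ) (A : Finset ℕ) (h u : ℕ) :
    0 ≤ ∑ j ∈ Finset.range (R + 1), mass M A j h u :=
  Finset.sum_nonneg fun _ _ => mass_nonneg _ _ _ _

theorem hitMass_nonneg (R : ℕ) (A : Finset ℕ) (G : Finset ℕ+) (i h u : ℕ) :
    0 ≤ hitMass M K R A G i h u := by
  refine levelAvg_nonneg (fun h' v => ?_) i h u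
  split_ifs
  · exact sum_mass_range_nonneg R _ h' v
  · exact le_rfl

/-- A node is level `0` of its own subtree, which it hits; its mass there is the `j = 0` summand. -/
theorem mass_singleton_le_hitMass (R : ℕ) {A : Finset ℕ} {z : ℕ} (hz : z ∈ A) (i h u : ℕ) :
    mass M {z} i h u ≤ hitMass M K R A {K z} i h u := by
  refine levelAvg_mono (fun h' v => ?_) i h u
  by_cases hv : v = z
  · subst hv
    rw [if_pos (Finset.mem_singleton_self v), if_pos ⟨v, le_rfl, lt_treeEnd h' v, by simp⟩]
    refine le_trans ?_ (Finset.single_le_sum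
      (f := fun j => mass M (hull A) j h' v) (fun _ _ => mass_nonneg _ _ _ _)
      (Finset.mem_range.2 (Nat.succ_pos R)))
    simp only [mass, levelAvg]
    rw [if_pos (subset_hull A hz)]
  · rw [if_neg (by simpa using hv)]
    split_ifs
    · exact sum_mass_range_nonneg R _ h' v
    · exact le_rfl

/-- Compare subtree by subtree at level `i`. A root in the hull contributes `1`, the most its
subtree can. If the root `v` is omitted but its subtree meets the hull, then `v < min A`, since
otherwise convexity would put `v` in the hull; as pre-order makes the subtree an interval, it
contains `min A` and is counted in the hit term. -/
theorem mass_hull_le (hM : ∀ u, 0 < M u) {R : ℕ} {A : Finset ℕ} (hA : A.Nonempty) {i j : ℕ}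
    (hij : i ≤ j) (u : ℕ) :
    mass M (hull A) j R u ≤ mass M (hull A) i R u + hitMass M K R A {K (A.min' hA)} i R u := by
  rcases lt_or_ge R j with hj | hj
  · rw [mass_eq_zero_of_lt _ _ hj]
    exact add_nonneg (mass_nonneg _ _ _ _) (hitMass_nonneg _ _ _ _ _ _)
  obtain ⟨l, rfl⟩ := Nat.exists_eq_add_of_le hij
  simp only [mass, hitMass]
  rw [← levelAvg_levelAvg, ← levelAvg_add]
  refine levelAvg_mono (fun h v => ?_) i R u
  change mass M (hull A) l h v ≤ _
  by_cases hv : v ∈ hull A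
  · rw [if_pos hv]
    refine (mass_le_one hM _ _ _ _).trans (le_add_of_nonneg_right ?_)
    split_ifs
    · exact sum_mass_range_nonneg R _ h v
    · exact le_rfl
  · rw [if_neg hv, zero_add]
    split_ifs with hhit
    · exact Finset.single_le_sum
        (f := fun j => mass M (hull A) j h v) (fun _ _ => mass_nonneg _ _ _ _)
        (Finset.mem_range.2 (by omega))
    · refine (mass_eq_zero (fun z hz h1 => ?_) l).le
      by_contra h2
      obtain ⟨a, ha, b, hb, haz, hzb⟩ := mem_hull.1 hz
      have h3 : A.min' hA ≤ z := (A.min'_le a ha).trans haz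
      rcases le_or_gt (A.min' hA) v with h4 | h4
      · exact hv (mem_hull.2 ⟨_, A.min'_mem hA, b, hb, h4, h1.trans hzb⟩)
      · exact hhit ⟨_, h4.le, by omega, by simp⟩

theorem sum_hitMass_le {r : ℕ} (R : ℕ) (A : Fin r → Finset ℕ) (B : Finset ℕ)
    (hd : ∀ i j, i ≠ j → Disjoint (hull (A i)) (hull (A j))) (hB : ∀ i, A i ⊆ B)
    (G : Fin r → Finset ℕ+) (i h u : ℕ) :
    ∑ l, hitMass M K R (A l) (G l) i h u ≤ hitMass M K R B (Finset.univ.biUnion G) i h u := by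
  classical
  simp only [hitMass]
  rw [← levelAvg_sum]
  refine levelAvg_mono (fun h' v => ?_) i h u
  by_cases hhit : Hits M K (Finset.univ.biUnion G) h' v
  · rw [if_pos hhit]
    calc _ ≤ ∑ l, ∑ j ∈ Finset.range (R + 1), mass M (hull (A l)) j h' v := by
          refine Finset.sum_le_sum fun l _ => ?_
          split_ifs
          · exact le_rfl
          · exact sum_mass_range_nonneg R _ h' v
      _ ≤ _ := by
          rw [Finset.sum_comm]
          exact Finset.sum_le_sum fun j _ => sum_mass_le _ _ hd (fun l => hull_mono (hB l)) _ _ _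
  · rw [if_neg hhit]
    refine (Finset.sum_eq_zero fun l _ => if_neg ?_).le
    rintro ⟨z, h1, h2, h3⟩
    exact hhit ⟨z, h1, h2, Finset.mem_biUnion.2 ⟨l, Finset.mem_univ _, h3⟩⟩

/-! ### Schreier sets of low order hit few subtrees. -/

open Classical in
/-- Fraction of the nodes of level `i` whose subtrees are hit by `G`. -/
def hitFrac (M : ℕ → ℕ) (K : ℕ → ℕ+) (G : Finset ℕ+) (i h u : ℕ) : ℝ :=
  levelAvg M (fun h' v => if Hits M K G h' v then 1 else 0) i h u

theorem hitFrac_le_one (hM : ∀ u, 0 < M u) (G : Finset ℕ+) (i h u : ℕ) :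
    hitFrac M K G i h u ≤ 1 :=
  levelAvg_le_one hM (fun _ _ => by split_ifs <;> norm_num) i h u

theorem hitFrac_biUnion_le {q : ℕ} (G : Fin q → Finset ℕ+) (i h u : ℕ) :
    hitFrac M K (Finset.univ.biUnion G) i h u ≤ ∑ l, hitFrac M K (G l) i h u := by
  classical
  simp only [hitFrac]
  rw [← levelAvg_sum]
  refine levelAvg_mono (fun h' v => ?_) i h u
  split_ifs with hhit
  · obtain ⟨z, h1, h2, h3⟩ := hhit
    obtain ⟨l, -, h4⟩ := Finset.mem_biUnion.1 h3
    refine le_trans ?_ (Finset.single_le_sum (fun l _ => by positivity) (Finset.mem_univ l))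
    rw [if_pos ⟨z, h1, h2, h4⟩]
  · positivity

theorem hitFrac_eq_zero {G : Finset ℕ+} {h u : ℕ} (hG : ¬ Hits M K G h u) (i : ℕ) :
    hitFrac M K G i h u = 0 := by
  classical
  refine le_antisymm ?_ (levelAvg_nonneg (fun _ _ => by positivity) i h u)
  rw [← levelAvg_zero (M := M) i h u]
  refine levelAvg_le_of_subtree i h u fun h' v h1 h2 => ?_
  rw [if_neg]
  rintro ⟨z, h3, h4, h5⟩
  exact hG ⟨z, h1.trans h3, h4.trans_le h2, h5⟩

theorem hitMass_le (hM : ∀ u, 0 < M u) (R : ℕ) (A : Finset ℕ) (G : Finset ℕ+) (i h u : ℕ) :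
    hitMass M K R A G i h u ≤ (R + 1) * hitFrac M K G i h u := by
  classical
  simp only [hitMass, hitFrac]
  rw [← levelAvg_const_mul]
  refine levelAvg_mono (fun h' v => ?_) i h u
  split_ifs
  · rw [mul_one]
    refine (Finset.sum_le_card_nsmul _ _ 1 fun j _ => mass_le_one hM _ _ _ _).trans ?_
    simp
  · simp

theorem four_pow_mul_le {M : ℕ → ℕ} (h4 : ∀ v, 4 * M v ≤ M (v + 1)) (v j : ℕ) :
    4 ^ j * M v ≤ M (v + j) := by
  induction j with
  | zero => simp
  | succ j ih =>
    calc 4 ^ (j + 1) * M v = 4 * (4 ^ j * M v) := by ring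
      _ ≤ 4 * M (v + j) := Nat.mul_le_mul_left _ ih
      _ ≤ M (v + (j + 1)) := h4 _

theorem monotone_of_four_mul_le {M : ℕ → ℕ} (h4 : ∀ v, 4 * M v ≤ M (v + 1)) : Monotone M :=
  monotone_nat_of_le_succ fun v => by have := h4 v; omega

/-- Children after the one whose subtree contains `z` have branching numbers exceeding `K z` by
growing powers of `4`. This makes the contributions of the later siblings in `hitFrac_le` summable.
-/
theorem four_pow_mul_le_child (h4 : ∀ v, 4 * M v ≤ M (v + 1)) (hK : ∀ v, 4 * (K v : ℕ) ≤ M (v + 1))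
    (hKm : Monotone K) {h u s z : ℕ} (hz : z < child M h u (s + 1)) (j : ℕ) :
    4 ^ (j + 1) * (K z : ℕ) ≤ M (child M h u (s + 1 + j)) := by
  have h1 : child M h u (s + 1) + j ≤ child M h u (s + 1 + j) := by
    induction j with
    | zero => simp
    | succ j ih =>
      have := child_strictMono (M := M) h u (Nat.lt_succ_self (s + 1 + j))
      rw [← Nat.add_assoc (s + 1) j 1]
      simp only [Nat.succ_eq_add_one] at this
      omega
  obtain ⟨y, hy⟩ : ∃ y, child M h u (s + 1) = y + 1 := ⟨child M h u (s + 1) - 1, by omega⟩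
  calc 4 ^ (j + 1) * (K z : ℕ) ≤ 4 ^ (j + 1) * (K y : ℕ) :=
        Nat.mul_le_mul_left _ (hKm (by omega : z ≤ y))
    _ = 4 ^ j * (4 * K y) := by ring
    _ ≤ 4 ^ j * M (y + 1) := Nat.mul_le_mul_left _ (hK y)
    _ ≤ M (y + 1 + j) := four_pow_mul_le h4 _ _
    _ ≤ _ := monotone_of_four_mul_le h4 (by rw [← hy]; exact h1)

theorem sum_four_pow_le (n : ℕ) : ∑ j ∈ Finset.range n, 2 / (4 : ℝ) ^ (j + 1) ≤ 1 := by
  have : ∑ j ∈ Finset.range n, 2 / (4 : ℝ) ^ (j + 1) = 2 / 3 - 2 / 3 / 4 ^ n := by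
    induction n with
    | zero => norm_num
    | succ n ih =>
      rw [Finset.sum_range_succ, ih]
      field_simp
      ring
  rw [this]
  have : (0 : ℝ) ≤ 2 / 3 / 4 ^ n := by positivity
  linarith

/-- If the numbers of children grow fast, then a set of `𝒮ₖ` hits a small fraction of the subtrees
rooted at level `i > k`. -/
theorem hitFrac_le (hM : ∀ u, 0 < M u) (h4 : ∀ v, 4 * M v ≤ M (v + 1))
    (hK : ∀ v, 4 * (K v : ℕ) ≤ M (v + 1)) (hKm : StrictMono K) (i : ℕ) :
    ∀ h u k, k < i → ∀ G ∈ Schreier k, hitFrac M K G i h u ≤ 2 / M u := by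
  induction i with
  | zero => intro h u k hk; omega
  | succ i ih =>
    intro h u k hk G hG
    cases h with
    | zero =>
      change (0 : ℝ) ≤ _
      positivity
    | succ h =>
      have hrec : hitFrac M K G (i + 1) (h + 1) u
        = (∑ s ∈ Finset.range (M u), hitFrac M K G i h (child M h u s)) / M u := rfl
      rw [hrec]
      refine div_le_div_of_nonneg_right ?_ (Nat.cast_nonneg _)
      by_cases hex : ∃ s, s < M u ∧ Hits M K G h (child M h u s)
      swap
      · push Not at hex
        rw [Finset.sum_eq_zero fun s hs => hitFrac_eq_zero (hex s (Finset.mem_range.1 hs)) i]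
        norm_num
      -- Child `s₀` is the first one hit: earlier ones contribute `0`, it contributes at most `1`,
      -- and the later ones will contribute at most `1` in total. This is the source of the constant
      -- `2`.
      obtain ⟨s₀, ⟨hs₀M, z, hz1, hz2, hzG⟩, hmin'⟩ : ∃ s₀, (s₀ < M u ∧
          Hits M K G h (child M h u s₀)) ∧ ∀ s < s₀, ¬ (s < M u ∧ Hits M K G h (child M h u s)) := by
        classical
        exact ⟨Nat.find hex, Nat.find_spec hex, fun s hs => Nat.find_min hex hs⟩
      have hmin : ∀ s < s₀, ¬ Hits M K G h (child M h u s) := fun s hs hh =>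
        hmin' s hs ⟨hs.trans hs₀M, hh⟩
      rw [← child_succ] at hz2
      obtain ⟨n, hn⟩ : ∃ n, M u = s₀ + 1 + n := Nat.exists_eq_add_of_le hs₀M
      rw [hn, Finset.sum_range_add, Finset.sum_range_succ,
        Finset.sum_eq_zero fun s hs => hitFrac_eq_zero (hmin s (Finset.mem_range.1 hs)) i, zero_add]
      -- A set of `𝒮ₖ₊₁` containing `K z` is a union of at most `K z` sets of `𝒮ₖ`. Induction
      -- applies to each of these, and the branching number of the later child dominates `4 ^ (j +
      -- 1) * K z`. For `k = 0` the only element is already used up in child `s₀`.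
      have hlater : ∀ j, hitFrac M K G i h (child M h u (s₀ + 1 + j)) ≤ 2 / 4 ^ (j + 1) := by
        intro j
        cases k with
        | zero =>
          rw [hitFrac_eq_zero]
          · positivity
          · rintro ⟨y, hy1, -, hyG⟩
            rcases hG with rfl | ⟨a, rfl⟩
            · simp at hzG
            · rw [Finset.mem_singleton] at hzG hyG
              have := hKm.injective (hzG.trans hyG.symm)
              have := (child_strictMono (M := M) h u).monotone (Nat.le_add_right (s₀ + 1) j)
              omega
        | succ k =>
          obtain ⟨q, H, hH, -, rfl, hq⟩ := hG
          refine (hitFrac_biUnion_le H _ _ _).trans ?_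
          refine (Finset.sum_le_card_nsmul _ _ _ fun l _ =>
            ih h (child M h u (s₀ + 1 + j)) k (by omega) (H l) (hH l).2).trans ?_
          have h1 := four_pow_mul_le_child h4 hK hKm.monotone hz2 j
          have h2 := hq _ hzG
          have h3 : (4 : ℝ) ^ (j + 1) * q ≤ M (child M h u (s₀ + 1 + j)) := by
            exact_mod_cast (Nat.mul_le_mul_left _ h2).trans h1
          have h5 : (0 : ℝ) < M (child M h u (s₀ + 1 + j)) := Nat.cast_pos.2 (hM _)
          rw [Finset.card_univ, Fintype.card_fin, nsmul_eq_mul, ← mul_div_assoc,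
            div_le_div_iff₀ h5 (by positivity)]
          linarith
      have := sum_four_pow_le n
      have h6 := hitFrac_le_one (K := K) hM G i h (child M h u s₀)
      have h7 := Finset.sum_le_sum fun j (_ : j ∈ Finset.range n) => hlater j
      linarith

end

/-! ### The upper bound in the mixed Tsirelson space. -/

section

variable {M : ℕ → ℕ} {K : ℕ → ℕ+}

/-- The coefficient of the node `z` in `∑ᵢ ϑ⁻ⁱ yᵢ`, where `yᵢ` is the average of level `i`. -/
def coef (ϑ : ℝ) (M : ℕ → ℕ) (R u z : ℕ) : ℝ :=
  ∑ i ∈ Finset.range (R + 1), (ϑ ^ i)⁻¹ * mass M {z} i R u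

/-- The vector `∑ᵢ ϑ⁻ⁱ yᵢ`, with the node `z` placed at `K z`. -/
def testVec (ϑ : ℝ) (M : ℕ → ℕ) (K : ℕ → ℕ+) (R u : ℕ) : C00 :=
  ∑ z ∈ Finset.range (treeEnd M R u), Finsupp.single (K z) (coef ϑ M R u z)

theorem coef_eq_zero (ϑ : ℝ) {R u z : ℕ} (hz : treeEnd M R u ≤ z) : coef ϑ M R u z = 0 := by
  refine Finset.sum_eq_zero fun i _ => ?_
  rw [mass_eq_zero fun y hy _ => by rw [Finset.mem_singleton.1 hy]; exact hz, mul_zero]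

theorem coef_nonneg {ϑ : ℝ} (hϑ : 0 < ϑ) (R u z : ℕ) : 0 ≤ coef ϑ M R u z :=
  Finset.sum_nonneg fun i _ => mul_nonneg (by positivity) (mass_nonneg _ _ _ _)

theorem testVec_apply (ϑ : ℝ) (hK : Function.Injective K) (R u z : ℕ) :
    testVec ϑ M K R u (K z) = coef ϑ M R u z := by
  rw [testVec, Finsupp.finsetSum_apply]
  simp only [Finsupp.single_apply, hK.eq_iff]
  rw [Finset.sum_ite_eq' (Finset.range (treeEnd M R u)) z]
  split_ifs with h
  · rfl
  · exact (coef_eq_zero ϑ (by simpa using h)).symm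

theorem testVec_apply_of_notMem (ϑ : ℝ) (R u : ℕ) {k : ℕ+} (hk : k ∉ Set.range K) :
    testVec ϑ M K R u k = 0 := by
  rw [testVec, Finsupp.finsetSum_apply]
  refine Finset.sum_eq_zero fun z _ => Finsupp.single_eq_of_ne fun h => hk ⟨z, h.symm⟩

open Classical in
/-- The largest mass which the trees of level `i` hit by a set of `𝒮ₖ` have in `A`. -/
def maxHit (M : ℕ → ℕ) (K : ℕ → ℕ+) (R u k i : ℕ) (A : Finset ℕ) : ℝ :=
  (((hull A).image K).powerset.filter (· ∈ Schreier k)).sup'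
    ⟨∅, by simp [empty_mem_schreier]⟩ fun G => hitMass M K R A G i R u

theorem hitMass_le_maxHit {R u k i : ℕ} {A : Finset ℕ} {G : Finset ℕ+} (hG : G ∈ Schreier k)
    (hGA : G ⊆ (hull A).image K) : hitMass M K R A G i R u ≤ maxHit M K R u k i A := by
  classical
  exact Finset.le_sup' (fun G => hitMass M K R A G i R u)
    (Finset.mem_filter.2 ⟨Finset.mem_powerset.2 hGA, hG⟩)

theorem exists_maxHit_eq (M : ℕ → ℕ) (K : ℕ → ℕ+) (R u k i : ℕ) (A : Finset ℕ) :
    ∃ G ∈ Schreier k, G ⊆ (hull A).image K ∧ maxHit M K R u k i A = hitMass M K R A G i R u := by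
  classical
  obtain ⟨G, hG, h⟩ := Finset.exists_mem_eq_sup'
    (s := ((hull A).image K).powerset.filter (· ∈ Schreier k))
    ⟨∅, by simp [empty_mem_schreier]⟩ fun G => hitMass M K R A G i R u
  rw [Finset.mem_filter, Finset.mem_powerset] at hG
  exact ⟨G, hG.2, hG.1, h⟩

theorem maxHit_nonneg (R u k i : ℕ) (A : Finset ℕ) : 0 ≤ maxHit M K R u k i A := by
  obtain ⟨G, -, -, h⟩ := exists_maxHit_eq M K R u k i A
  rw [h]
  exact hitMass_nonneg _ _ _ _ _ _

theorem mass_singleton_le_maxHit {R u : ℕ} (k i : ℕ) {A : Finset ℕ} {z : ℕ} (hz : z ∈ A) :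
    mass M {z} i R u ≤ maxHit M K R u k i A := by
  classical
  refine (mass_singleton_le_hitMass (K := K) R hz i R u).trans
    (hitMass_le_maxHit (singleton_mem_schreier k _) ?_)
  rw [Finset.singleton_subset_iff]
  exact Finset.mem_image_of_mem _ (subset_hull A hz)

theorem mass_hull_le_maxHit (hM : ∀ u, 0 < M u) {R : ℕ} (A : Finset ℕ) {i j : ℕ}
    (hij : i ≤ j) (u : ℕ) :
    mass M (hull A) j R u ≤ mass M (hull A) i R u + maxHit M K R u 0 i A := by
  classical
  rcases A.eq_empty_or_nonempty with rfl | hA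
  · rw [mass_eq_zero (by simp [hull])]
    exact add_nonneg (mass_nonneg _ _ _ _) (maxHit_nonneg _ _ _ _ _)
  · refine (mass_hull_le (K := K) hM hA hij u).trans (add_le_add_right ?_ _)
    refine hitMass_le_maxHit (singleton_mem_schreier 0 _) ?_
    rw [Finset.singleton_subset_iff]
    exact Finset.mem_image_of_mem _ (subset_hull A (A.min'_mem hA))

theorem Admissible.lt_of_mem_hull {n r : ℕ} {E : Fin r → Finset ℕ+} (hE : Admissible n r E)
    (hK : StrictMono K) {A : Fin r → Finset ℕ} (hA : ∀ l, ∀ z ∈ A l, K z ∈ E l) {i j : Fin r}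
    (hij : i < j) {z w : ℕ} (hz : z ∈ hull (A i)) (hw : w ∈ hull (A j)) : z < w := by
  obtain ⟨-, -, b, hb, -, hzb⟩ := mem_hull.1 hz
  obtain ⟨a, ha, -, -, haw, -⟩ := mem_hull.1 hw
  have := hK.lt_iff_lt.1 (hE.1 i j hij _ (hA i b hb) _ (hA j a ha))
  omega

theorem Admissible.disjoint_hull {n r : ℕ} {E : Fin r → Finset ℕ+} (hE : Admissible n r E)
    (hK : StrictMono K) {A : Fin r → Finset ℕ} (hA : ∀ l, ∀ z ∈ A l, K z ∈ E l) (i j : Fin r)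
    (hij : i ≠ j) : Disjoint (hull (A i)) (hull (A j)) := by
  rw [Finset.disjoint_left]
  intro z hz hz'
  rcases lt_or_gt_of_ne hij with h | h
  · exact lt_irrefl _ (hE.lt_of_mem_hull hK hA h hz hz')
  · exact lt_irrefl _ (hE.lt_of_mem_hull hK hA h hz' hz)

/-- Choose an optimal `G l` in the image of each hull. Admissibility makes these sets successive and
each lies to the right of `min (E l)`, so their union has Schreier order `k + n` and competes in the
right-hand maximum. -/
theorem sum_maxHit_le {n r : ℕ} {E : Fin r → Finset ℕ+} (hE : Admissible n r E)
    (hK : StrictMono K) {A : Fin r → Finset ℕ} (hA : ∀ l, ∀ z ∈ A l, K z ∈ E l)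
    {B : Finset ℕ} (hB : ∀ l, A l ⊆ B) (R u k i : ℕ) :
    ∑ l, maxHit M K R u k i (A l) ≤ maxHit M K R u (k + n) i B := by
  choose G hG hGA hmax using fun l => exists_maxHit_eq M K R u k i (A l)
  simp only [hmax]
  refine (sum_hitMass_le R A B (hE.disjoint_hull hK hA) hB G i R u).trans
    (hitMass_le_maxHit (hE.biUnion_mem G hG ?_ ?_) ?_)
  · intro l b hb
    obtain ⟨z, hz, rfl⟩ := Finset.mem_image.1 (hGA l hb)
    obtain ⟨a, ha, -, -, haz, -⟩ := mem_hull.1 hz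
    exact ⟨K a, hA l a ha, hK.monotone haz⟩
  · intro i j hij x hx y hy
    obtain ⟨z, hz, rfl⟩ := Finset.mem_image.1 (hGA i hx)
    obtain ⟨w, hw, rfl⟩ := Finset.mem_image.1 (hGA j hy)
    exact hK (hE.lt_of_mem_hull hK hA hij hz hw)
  · intro b hb
    obtain ⟨l, -, hl⟩ := Finset.mem_biUnion.1 hb
    exact Finset.image_subset_image (hull_mono (hB l)) (hGA l hl)

/-- The bound for `ϑᴺ ‖Ex‖`, where `x` is the test vector and `A` is the set of nodes in `E`. -/
def normBound (ϑ b W : ℝ) (M : ℕ → ℕ) (K : ℕ → ℕ+) (R u N : ℕ) (A : Finset ℕ) : ℝ :=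
  ∑ i ∈ Finset.range (R + 1), (if i ≤ N then ϑ ^ (N - i) * mass M (hull A) i R u
    else W * maxHit M K R u (i - N - 1) i A) + b * mass M (hull A) (N + 1) R u

theorem normBound_nonneg {ϑ b W : ℝ} (hϑ : 0 < ϑ) (hb : 0 ≤ b) (hW : 0 ≤ W) (R u N : ℕ)
    (A : Finset ℕ) : 0 ≤ normBound ϑ b W M K R u N A := by
  refine add_nonneg (Finset.sum_nonneg fun i _ => ?_) (mul_nonneg hb (mass_nonneg _ _ _ _))
  split_ifs
  · exact mul_nonneg (by positivity) (mass_nonneg _ _ _ _)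
  · exact mul_nonneg hW (maxHit_nonneg _ _ _ _ _)

/-- The sup-norm case of the induction. Levels above `N` are absorbed by the hit terms, which is why
`W` must dominate `ϑ⁻ᴿ`. -/
theorem pow_mul_coef_le_normBound {ϑ b W : ℝ} (hϑ : 0 < ϑ) (hϑ1 : ϑ < 1) (hb : 0 ≤ b) {R : ℕ}
    (hW : (ϑ ^ R)⁻¹ ≤ W) (u N : ℕ) {A : Finset ℕ} {z : ℕ} (hz : z ∈ A) :
    ϑ ^ N * coef ϑ M R u z ≤ normBound ϑ b W M K R u N A := by
  rw [coef, Finset.mul_sum, normBound]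
  refine le_add_of_le_of_nonneg (Finset.sum_le_sum fun i hi => ?_)
    (mul_nonneg hb (mass_nonneg _ _ _ _))
  split_ifs with h
  · rw [← mul_assoc, ← pow_sub₀ ϑ hϑ.ne' h]
    exact mul_le_mul_of_nonneg_left
      (mass_mono (Finset.singleton_subset_iff.2 (subset_hull A hz)) _ _ _) (by positivity)
  · have h1 : ϑ ^ N * (ϑ ^ i)⁻¹ ≤ W := by
      refine le_trans ?_ hW
      calc ϑ ^ N * (ϑ ^ i)⁻¹ ≤ 1 * (ϑ ^ i)⁻¹ :=
            mul_le_mul_of_nonneg_right (pow_le_one₀ hϑ.le hϑ1.le) (by positivity)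
        _ = (ϑ ^ i)⁻¹ := one_mul _
        _ ≤ (ϑ ^ R)⁻¹ := inv_anti₀ (by positivity)
            (pow_le_pow_of_le_one hϑ.le hϑ1.le (by simpa [Nat.lt_succ_iff] using hi))
    rw [← mul_assoc]
    exact mul_le_mul h1 (mass_singleton_le_maxHit _ _ hz) (mass_nonneg _ _ _ _)
      (le_trans (by positivity) hW)

theorem sum_pow_sub_le {ϑ : ℝ} (hϑ : 0 < ϑ) (hϑ1 : ϑ < 1) (R N : ℕ) :
    ∑ i ∈ Finset.range (R + 1), (if i ≤ N then ϑ ^ (N - i) else 0) ≤ (1 - ϑ)⁻¹ := by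
  calc _ = ∑ i ∈ (Finset.range (R + 1)).filter (· ≤ N), ϑ ^ (N - i) :=
        (Finset.sum_filter _ _).symm
    _ ≤ ∑ i ∈ Finset.range (N + 1), ϑ ^ (N - i) :=
        Finset.sum_le_sum_of_subset_of_nonneg (fun i hi => by
          rw [Finset.mem_filter] at hi
          exact Finset.mem_range.2 (by omega)) fun _ _ _ => by positivity
    _ = ∑ i ∈ Finset.range (N + 1), ϑ ^ i := by
        rw [← Finset.sum_range_reflect]
        refine Finset.sum_congr rfl fun i hi => ?_
        rw [Finset.mem_range] at hi
        congr 1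
        omega
    _ ≤ _ := by
        rw [← tsum_geometric_of_lt_one hϑ.le hϑ1]
        exact (summable_geometric_of_lt_one hϑ.le hϑ1).sum_le_tsum _ fun _ _ => by positivity

/-- The induction step, with `N` the total Schreier order already spent. Levels up to `N` have their
weight reduced by `d ϑⁿ`. Levels `N + 1, …, N + n` and the reserve term at level `N + n + 1` are all
compared with level `N + 1`; their weights add up to `(1 - ϑ)⁻¹ + b` at most, and the factor `d`
brings this back to `b`. On deeper levels the Schreier order of the hitting sets rises by `n`,
exactly compensating the shift of `N`. -/
theorem mul_sum_normBound_le {ϑ b W d : ℝ} (hϑ : 0 < ϑ) (hϑ1 : ϑ < 1) (hd : 0 < d) (hd1 : d < 1)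
    (hb : 0 ≤ b) (hdb : d * ((1 - ϑ)⁻¹ + b) ≤ b) (hbW : b ≤ W) (hM : ∀ u, 0 < M u)
    (hK : StrictMono K) {n r : ℕ} (hn : 0 < n) {E : Fin r → Finset ℕ+} (hE : Admissible n r E)
    {A : Fin r → Finset ℕ} (hA : ∀ l, ∀ z ∈ A l, K z ∈ E l) {B : Finset ℕ} (hB : ∀ l, A l ⊆ B)
    (R u N : ℕ) :
    d * ∑ l, normBound ϑ b W M K R u (N + n) (A l) ≤ normBound ϑ b W M K R u N B := by
  have hW : 0 ≤ W := hb.trans hbW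
  set Y : ℕ → ℝ := fun i => mass M (hull B) i R u with hY
  set t : ℕ → ℕ → ℝ := fun k i => maxHit M K R u k i B with ht
  have hY0 : ∀ i, 0 ≤ Y i := fun i => mass_nonneg _ _ _ _
  have ht0 : ∀ k i, 0 ≤ t k i := fun k i => maxHit_nonneg _ _ _ _ _
  have hYsum : ∀ i, ∑ l, mass M (hull (A l)) i R u ≤ Y i := fun i =>
    sum_mass_le _ _ (hE.disjoint_hull hK hA) (fun l => hull_mono (hB l)) i R u
  have h1 : ∑ l, normBound ϑ b W M K R u (N + n) (A l) ≤
      ∑ i ∈ Finset.range (R + 1), (if i ≤ N + n then ϑ ^ (N + n - i) * Y i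
        else W * t (i - N - 1) i) + b * Y (N + n + 1) := by
    simp only [normBound]
    rw [Finset.sum_add_distrib, Finset.sum_comm, ← Finset.mul_sum]
    refine add_le_add (Finset.sum_le_sum fun i _ => ?_)
      (mul_le_mul_of_nonneg_left (hYsum _) hb)
    split_ifs with h
    · rw [← Finset.mul_sum]
      exact mul_le_mul_of_nonneg_left (hYsum _) (by positivity)
    · rw [← Finset.mul_sum]
      refine mul_le_mul_of_nonneg_left ?_ hW
      have := sum_maxHit_le (M := M) hE hK hA hB R u (i - (N + n) - 1) i
      rwa [show i - (N + n) - 1 + n = i - N - 1 by omega] at this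
  refine (mul_le_mul_of_nonneg_left h1 hd.le).trans ?_
  change _ ≤ ∑ i ∈ Finset.range (R + 1), (if i ≤ N then ϑ ^ (N - i) * Y i
    else W * t (i - N - 1) i) + b * Y (N + 1)
  have hpow : ∀ i, i ≤ N → d * (ϑ ^ (N + n - i) * Y i) ≤ ϑ ^ (N - i) * Y i := by
    intro i hi
    rw [← mul_assoc]
    refine mul_le_mul_of_nonneg_right ?_ (hY0 i)
    calc d * ϑ ^ (N + n - i) ≤ 1 * ϑ ^ (N - i) :=
          mul_le_mul hd1.le (pow_le_pow_of_le_one hϑ.le hϑ1.le (by omega)) (by positivity)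
            zero_le_one
      _ = _ := one_mul _
  -- If level `N + 1` does not exist, the reserve term vanishes and only levels `i ≤ N` occur.
  rcases lt_or_ge R (N + 1) with hR | hR
  · have hz : Y (N + n + 1) = 0 := mass_eq_zero_of_lt _ _ (by omega)
    rw [hz, mul_zero, add_zero, Finset.mul_sum]
    refine le_add_of_le_of_nonneg (Finset.sum_le_sum fun i hi => ?_) (mul_nonneg hb (hY0 _))
    have hi' : i ≤ N := by rw [Finset.mem_range] at hi; omega
    rw [if_pos (by omega), if_pos hi']
    exact hpow i hi'
  · set e := t 0 (N + 1) with he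
    have herr : ∀ j, N + 1 ≤ j → Y j ≤ Y (N + 1) + e := fun j hj =>
      mass_hull_le_maxHit hM B hj u
    have hYe : 0 ≤ Y (N + 1) + e := add_nonneg (hY0 _) (ht0 _ _)
    -- The comparison with level `N + 1` costs an error `b * e`. It is paid by the hit term `W * t 0
    -- (N + 1)` on the right: since `n ≥ 1`, level `N + 1` has no hit term on the left, so this one
    -- is free, and `b ≤ W` makes it large enough.
    have hterm : ∀ i ∈ Finset.range (R + 1),
        d * (if i ≤ N + n then ϑ ^ (N + n - i) * Y i else W * t (i - N - 1) i)
          + (if i = N + 1 then b * e else 0) ≤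
        (if i ≤ N then ϑ ^ (N - i) * Y i else W * t (i - N - 1) i)
          + d * (Y (N + 1) + e) * (if i ≤ N + n then ϑ ^ (N + n - i) else 0) := by
      intro i _
      rcases le_or_gt i N with h | h
      · rw [if_pos (by omega), if_neg (by omega), if_pos h, if_pos (by omega), add_zero]
        exact le_add_of_le_of_nonneg (hpow i h) (by positivity)
      have hbt : (if i = N + 1 then b * e else 0) ≤ W * t (i - N - 1) i := by
        split_ifs with h2
        · subst h2
          rw [show N + 1 - N - 1 = 0 by omega]
          exact mul_le_mul_of_nonneg_right hbW (ht0 _ _)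
        · exact mul_nonneg hW (ht0 _ _)
      rw [if_neg (by omega : ¬ i ≤ N)]
      rcases le_or_gt i (N + n) with h3 | h3
      · rw [if_pos h3, if_pos h3, add_comm]
        refine add_le_add hbt ?_
        calc d * (ϑ ^ (N + n - i) * Y i) ≤ d * (ϑ ^ (N + n - i) * (Y (N + 1) + e)) := by
              have := herr i h
              gcongr
          _ = _ := by ring
      · rw [if_neg (by omega), if_neg (by omega), if_neg (by omega), mul_zero]
        refine add_le_add ?_ le_rfl
        exact mul_le_of_le_one_left (mul_nonneg hW (ht0 _ _)) hd1.le
    have hsum := Finset.sum_le_sum hterm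
    rw [Finset.sum_add_distrib, Finset.sum_add_distrib, ← Finset.mul_sum, ← Finset.mul_sum,
      Finset.sum_ite_eq' (Finset.range (R + 1)) (N + 1), if_pos (by simpa using hR)] at hsum
    have hgeo := mul_le_mul_of_nonneg_left (sum_pow_sub_le hϑ hϑ1 R (N + n))
      (mul_nonneg hd.le hYe)
    have hlast : d * (b * Y (N + n + 1)) ≤ d * (b * (Y (N + 1) + e)) := by
      have := herr (N + n + 1) (by omega)
      gcongr
    have hfin := mul_le_mul_of_nonneg_right hdb hYe
    rw [mul_add]
    nlinarith

theorem preimage_inter_subset (hK : StrictMono K) (F E : Finset ℕ+) :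
    (F ∩ E).preimage K hK.injective.injOn ⊆ E.preimage K hK.injective.injOn := by
  intro z hz
  rw [Finset.mem_preimage] at hz ⊢
  exact (Finset.mem_inter.1 hz).2

theorem restrict_restrict (F E : Finset ℕ+) (x : C00) :
    restrict F (restrict E x) = restrict (F ∩ E) x := by
  ext k
  simp only [restrict, Finsupp.filter_apply, Finset.mem_inter]
  split_ifs <;> simp_all

/-- The weight `ϑ ^ N` records the factors `ϑⁿ` from enclosing admissible families, so a step of
order `n` passes from `N` to `N + n`. The induction therefore needs all `E` and `N` at once. -/
theorem pow_mul_iterNorm_le {ϑ b W d : ℝ} (hϑ : 0 < ϑ) (hϑ1 : ϑ < 1) (hd : 0 < d) (hd1 : d < 1)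
    (hb : 0 ≤ b) (hdb : d * ((1 - ϑ)⁻¹ + b) ≤ b) (hbW : b ≤ W) (hM : ∀ u, 0 < M u)
    (hK : StrictMono K) {R : ℕ} (hW : (ϑ ^ R)⁻¹ ≤ W) (u : ℕ) {θ : ℕ+ → ℝ}
    (hθ : ∀ n, θ n ≤ d * ϑ ^ (n : ℕ)) (m : ℕ) : ∀ (E : Finset ℕ+) (N : ℕ),
    ϑ ^ N * iterNorm Admissible θ m (restrict E (testVec ϑ M K R u)) ≤
      normBound ϑ b W M K R u N (E.preimage K hK.injective.injOn) := by
  have hnn : ∀ N A, 0 ≤ normBound ϑ b W M K R u N A := fun N A =>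
    normBound_nonneg hϑ hb (hb.trans hbW) R u N A
  induction m with
  | zero =>
    intro E N
    rw [← le_div_iff₀' (by positivity)]
    refine ciSup_le fun k => ?_
    rw [le_div_iff₀' (by positivity)]
    simp only [restrict, Finsupp.filter_apply]
    split_ifs with hk
    · by_cases hkr : k ∈ Set.range K
      · obtain ⟨z, rfl⟩ := hkr
        rw [testVec_apply ϑ hK.injective, abs_of_nonneg (coef_nonneg hϑ _ _ _)]
        exact pow_mul_coef_le_normBound hϑ hϑ1 hb hW u N (Finset.mem_preimage.2 hk)
      · rw [testVec_apply_of_notMem ϑ R u hkr, abs_zero, mul_zero]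
        exact hnn _ _
    · rw [abs_zero, mul_zero]
      exact hnn _ _
  | succ m ih =>
    intro E N
    rw [← le_div_iff₀' (by positivity)]
    refine max_le ?_ (Real.sSup_le ?_ (div_nonneg (hnn _ _) (by positivity)))
    · rw [le_div_iff₀' (by positivity)]
      exact ih E N
    · rintro _ ⟨n, r, F, hF, rfl⟩
      rw [le_div_iff₀' (by positivity)]
      simp only [restrict_restrict]
      have h0 : 0 ≤ ∑ i, iterNorm Admissible θ m (restrict (F i ∩ E) (testVec ϑ M K R u)) :=
        Finset.sum_nonneg fun _ _ => iterNorm_nonneg m _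
      calc _ ≤ ϑ ^ N * (d * ϑ ^ (n : ℕ) *
            ∑ i, iterNorm Admissible θ m (restrict (F i ∩ E) (testVec ϑ M K R u))) := by
            have := hθ n
            gcongr
        _ = d * ∑ i, ϑ ^ (N + n) *
              iterNorm Admissible θ m (restrict (F i ∩ E) (testVec ϑ M K R u)) := by
            rw [← Finset.mul_sum, pow_add]; ring
        _ ≤ d * ∑ i, normBound ϑ b W M K R u (N + n)
              ((F i ∩ E).preimage K hK.injective.injOn) :=
            mul_le_mul_of_nonneg_left (Finset.sum_le_sum fun i _ => ih _ _) hd.le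
        _ ≤ _ := mul_sum_normBound_le hϑ hϑ1 hd hd1 hb hdb hbW hM hK n.pos hF
            (fun l z hz => (Finset.mem_inter.1 (Finset.mem_preimage.1 hz)).1)
            (fun l => preimage_inter_subset hK _ _) R u N

/-- The test vectors are bounded in the mixed Tsirelson space, independently of their number of
levels. -/
theorem limNorm_testVec_le {ϑ b d : ℝ} (hϑ : 0 < ϑ) (hϑ1 : ϑ < 1) (hd : 0 < d) (hd1 : d < 1)
    (hb : 0 ≤ b) (hdb : d * ((1 - ϑ)⁻¹ + b) ≤ b) (hM : ∀ u, 0 < M u)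
    (h4 : ∀ v, 4 * M v ≤ M (v + 1)) (hMK : ∀ v, 4 * (K v : ℕ) ≤ M (v + 1)) (hK : StrictMono K)
    {R u : ℕ} (hu : (b + (ϑ ^ R)⁻¹) * (2 * (R + 1) ^ 2) ≤ M u) {θ : ℕ+ → ℝ}
    (hθ : ∀ n, θ n ≤ d * ϑ ^ (n : ℕ)) :
    limNorm Admissible θ (testVec ϑ M K R u) ≤ 2 + b := by
  refine ciSup_le fun m => ?_
  set x := testVec ϑ M K R u with hx
  set W := b + (ϑ ^ R)⁻¹ with hWdef
  have hW : 0 ≤ W := by positivity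
  -- Take `N = 0` and `E` the whole support. The root level gives at most `1`, the reserve term at
  -- most `b`, and the hit terms together at most `1` by the size of `M u`.
  have h1 := pow_mul_iterNorm_le hϑ hϑ1 hd hd1 hb hdb (W := W)
    (le_add_of_nonneg_right (by positivity)) hM hK (R := R) (le_add_of_nonneg_left hb) u hθ m
    x.support 0
  have h2 : restrict x.support x = x := by
    ext k
    simp only [restrict, Finsupp.filter_apply]
    split_ifs with hk
    · rfl
    · exact (Finsupp.notMem_support_iff.1 hk).symm
  rw [← hx, h2, pow_zero, one_mul] at h1
  refine h1.trans ?_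
  set A := x.support.preimage K hK.injective.injOn
  have hMu : (0 : ℝ) < M u := Nat.cast_pos.2 (hM u)
  have hsmall : ∀ i, i ≠ 0 → W * maxHit M K R u (i - 0 - 1) i A ≤ W * ((R + 1) * (2 / M u)) := by
    intro i hi
    refine mul_le_mul_of_nonneg_left ?_ hW
    obtain ⟨G, hG, -, h⟩ := exists_maxHit_eq M K R u (i - 0 - 1) i A
    rw [h]
    refine (hitMass_le hM R A G i R u).trans (mul_le_mul_of_nonneg_left ?_ (by positivity))
    exact hitFrac_le hM h4 hMK hK i R u _ (by omega) G hG
  have hsum : ∑ i ∈ Finset.range (R + 1), (if i ≤ 0 then ϑ ^ (0 - i) * mass M (hull A) i R u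
      else W * maxHit M K R u (i - 0 - 1) i A) ≤
      ∑ i ∈ Finset.range (R + 1), ((if i = 0 then 1 else 0) + W * ((R + 1) * (2 / M u))) := by
    refine Finset.sum_le_sum fun i _ => ?_
    rcases eq_or_ne i 0 with rfl | hi
    · rw [if_pos le_rfl, if_pos rfl, Nat.sub_zero, pow_zero, one_mul]
      exact le_add_of_le_of_nonneg (mass_le_one hM _ _ _ _) (by positivity)
    · rw [if_neg (by omega), if_neg hi, zero_add]
      exact hsmall i hi
  rw [Finset.sum_add_distrib, Finset.sum_ite_eq', if_pos (by simp), Finset.sum_const,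
    Finset.card_range, nsmul_eq_mul] at hsum
  have h3 : ((R + 1 : ℕ) : ℝ) * (W * ((R + 1) * (2 / M u))) ≤ 1 := by
    rw [show ((R + 1 : ℕ) : ℝ) * (W * ((R + 1) * (2 / M u))) = W * (2 * (R + 1) ^ 2) / M u by
      push_cast; ring, div_le_one hMu]
    exact hu
  have h5 := mul_le_mul_of_nonneg_left (mass_le_one hM (hull A) (0 + 1) R u) hb
  rw [normBound]
  linarith

end

/-! ### The lower bound in the modified space. -/

section

variable {M : ℕ → ℕ}

/-- The nodes of level `i` of the tree of height `h` with root `u`. -/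
def levelSet (M : ℕ → ℕ) : ℕ → ℕ → ℕ → Finset ℕ
  | 0, _, u => {u}
  | _ + 1, 0, _ => ∅
  | i + 1, h + 1, u => (Finset.range (M u)).biUnion fun s => levelSet M i h (child M h u s)

theorem mem_levelSet_succ {i h u z : ℕ} : z ∈ levelSet M (i + 1) (h + 1) u ↔
    ∃ s < M u, z ∈ levelSet M i h (child M h u s) := by
  simp [levelSet]

theorem mem_Ico_of_mem_levelSet (i : ℕ) : ∀ h u, ∀ z ∈ levelSet M i h u,
    u ≤ z ∧ z < treeEnd M h u := by
  induction i with
  | zero =>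
    intro h u z hz
    rw [Finset.mem_singleton.1 hz]
    exact ⟨le_rfl, lt_treeEnd h u⟩
  | succ i ih =>
    intro h u z hz
    cases h with
    | zero => simp [levelSet] at hz
    | succ h =>
      obtain ⟨s, hs, hz⟩ := mem_levelSet_succ.1 hz
      obtain ⟨h1, h2⟩ := ih h _ z hz
      exact ⟨(lt_child h u s).le.trans h1, h2.trans_le (treeEnd_child_le h u hs)⟩

theorem eq_of_mem_levelSet (i : ℕ) : ∀ j h u z, z ∈ levelSet M i h u → z ∈ levelSet M j h u →
    i = j := by
  have key : ∀ h u z s, z ∈ levelSet M 0 (h + 1) u → ∀ j, z ∉ levelSet M j h (child M h u s) := by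
    intro h u z s hz j hz'
    have h1 := (mem_Ico_of_mem_levelSet j h _ z hz').1
    have h2 := lt_child (M := M) h u s
    rw [Finset.mem_singleton.1 hz] at h1
    omega
  induction i with
  | zero =>
    intro j h u z hz hz'
    cases j with
    | zero => rfl
    | succ j =>
      cases h with
      | zero => simp [levelSet] at hz'
      | succ h =>
        obtain ⟨s, -, hs⟩ := mem_levelSet_succ.1 hz'
        exact absurd hs (key h u z s hz j)
  | succ i ih =>
    intro j h u z hz hz'
    cases h with
    | zero => simp [levelSet] at hz
    | succ h =>
      obtain ⟨s, -, hs⟩ := mem_levelSet_succ.1 hz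
      cases j with
      | zero => exact absurd hs (key h u z s hz' i)
      | succ j =>
        obtain ⟨s', -, hs'⟩ := mem_levelSet_succ.1 hz'
        have hss : s = s' := by
          obtain ⟨h1, h2⟩ := mem_Ico_of_mem_levelSet i h _ z hs
          obtain ⟨h3, h4⟩ := mem_Ico_of_mem_levelSet j h _ z hs'
          rw [← child_succ] at h2 h4
          have h5 := (child_strictMono (M := M) h u).lt_iff_lt.1 (h1.trans_lt h4)
          have h6 := (child_strictMono (M := M) h u).lt_iff_lt.1 (h3.trans_lt h2)
          omega
        rw [hss] at hs
        rw [ih j h _ z hs hs']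

/-- Pre-order makes the subtrees of the children of `u` successive, and there are `M u ≤ q u` of
them, below all their positions. So each level raises the Schreier order by one. -/
theorem image_levelSet_mem_schreier {q : ℕ → ℕ+} (hq : StrictMono q) (hMq : ∀ z, M z ≤ q z)
    (i : ℕ) : ∀ h u, (levelSet M i h u).image q ∈ Schreier i := by
  induction i with
  | zero => exact fun h u => Or.inr ⟨q u, by simp [levelSet]⟩
  | succ i ih =>
    intro h u
    cases h with
    | zero => simpa [levelSet] using empty_mem_schreier (i + 1)
    | succ h =>
      have heq : (levelSet M (i + 1) (h + 1) u).image q = Finset.univ.biUnion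
          fun s : Fin (M u) => (levelSet M i h (child M h u s)).image q := by
        ext a
        simp only [Finset.mem_image, Finset.mem_biUnion, mem_levelSet_succ, Finset.mem_univ,
          true_and]
        constructor
        · rintro ⟨z, ⟨s, hs, hz⟩, rfl⟩
          exact ⟨⟨s, hs⟩, z, hz, rfl⟩
        · rintro ⟨s, z, hz, rfl⟩
          exact ⟨z, ⟨s, s.2, hz⟩, rfl⟩
      rw [heq]
      refine biUnion_mem_schreier_succ _ (fun s => ih h _) ?_ ?_
      · intro s s' hss x hx y hy
        obtain ⟨z, hz, rfl⟩ := Finset.mem_image.1 hx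
        obtain ⟨w, hw, rfl⟩ := Finset.mem_image.1 hy
        have h1 := (mem_Ico_of_mem_levelSet i h _ z hz).2
        have h2 := (mem_Ico_of_mem_levelSet i h _ w hw).1
        rw [← child_succ] at h1
        have h3 := (child_strictMono (M := M) h u).monotone (Nat.succ_le_of_lt hss)
        exact hq ((h1.trans_le h3).trans_le h2)
      · intro s x hx
        obtain ⟨z, hz, rfl⟩ := Finset.mem_image.1 hx
        have h1 := (mem_Ico_of_mem_levelSet i h _ z hz).1
        have h2 := lt_child (M := M) h u s
        exact (hMq u).trans (hq.monotone (by omega : u ≤ z))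

theorem mass_of_levelSet_subset (hM : ∀ u, 0 < M u) {S : Finset ℕ} (i : ℕ) : ∀ h u, i ≤ h →
    levelSet M i h u ⊆ S → mass M S i h u = 1 := by
  induction i with
  | zero =>
    intro h u _ hS
    exact if_pos (hS (Finset.mem_singleton_self u))
  | succ i ih =>
    intro h u hi hS
    cases h with
    | zero => omega
    | succ h =>
      have hrec : mass M S (i + 1) (h + 1) u
        = (∑ s ∈ Finset.range (M u), mass M S i h (child M h u s)) / M u := rfl
      rw [hrec, Finset.sum_congr rfl fun s hs => ih h _ (by omega) fun z hz =>
        hS (mem_levelSet_succ.2 ⟨s, Finset.mem_range.1 hs, hz⟩)]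
      have : (M u : ℝ) ≠ 0 := Nat.cast_ne_zero.2 (hM u).ne'
      simp [this]

theorem mass_eq_sum_singleton (S : Finset ℕ) (i h u : ℕ) :
    mass M S i h u = ∑ z ∈ S, mass M {z} i h u := by
  simp only [mass]
  rw [← levelAvg_sum]
  congr 1
  ext _ v
  simp

theorem sum_levelSet_mass (hM : ∀ u, 0 < M u) {i h : ℕ} (u : ℕ) (hi : i ≤ h) :
    ∑ z ∈ levelSet M i h u, mass M {z} i h u = 1 := by
  rw [← mass_eq_sum_singleton]
  exact mass_of_levelSet_subset hM i h u hi subset_rfl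

theorem mem_schreier_one_of_card_le {F : Finset ℕ+} (hF : ∀ a ∈ F, F.card ≤ (a : ℕ)) :
    F ∈ Schreier 1 := by
  have : F = Finset.univ.biUnion fun i => {F.orderEmbOfFin rfl i} := by
    ext a
    have : a ∈ F ↔ a ∈ Set.range (F.orderEmbOfFin rfl) := by
      rw [Finset.range_orderEmbOfFin]; rfl
    simp only [Finset.mem_biUnion, Finset.mem_univ, true_and, Finset.mem_singleton]
    exact this.trans ⟨fun ⟨i, h⟩ => ⟨i, h.symm⟩, fun ⟨i, h⟩ => ⟨i, h.symm⟩⟩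
  rw [this]
  refine biUnion_mem_schreier_succ _ (fun i => singleton_mem_schreier 0 _) ?_ ?_
  · intro i j hij a ha b hb
    rw [Finset.mem_singleton.1 ha, Finset.mem_singleton.1 hb]
    exact (F.orderEmbOfFin rfl).strictMono hij
  · intro i a ha
    rw [Finset.mem_singleton.1 ha]
    exact hF _ (F.orderEmbOfFin_mem rfl i)

section
variable {P : ℕ → ∀ r : ℕ, (Fin r → Finset ℕ+) → Prop} {θ : ℕ+ → ℝ}

theorem mul_sum_limNorm_le (hP : PairwiseDisj P) (hθ : ∀ n, θ n ∈ Set.Ioo (0 : ℝ) 1) (x : C00)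
    (n : ℕ+) (r : ℕ) (E : Fin r → Finset ℕ+) (hE : P n r E) :
    θ n * ∑ i, limNorm P θ (restrict (E i) x) ≤ limNorm P θ x := by
  refine le_of_tendsto (f := fun m => θ n * ∑ i, iterNorm P θ m (restrict (E i) x))
    (tendsto_const_nhds.mul (tendsto_finsetSum _ fun i _ => tendsto_iterNorm hP hθ _))
    (Eventually.of_forall fun m => ?_)
  exact (le_iterNorm_succ hP hθ m x n r E hE).trans (le_ciSup (bddAbove_iterNorm hP hθ x) _)

theorem limNorm_smul (hP : PairwiseDisj P) (hθ : ∀ n, θ n ∈ Set.Ioo (0 : ℝ) 1) (c : ℝ)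
    (x : C00) : limNorm P θ (c • x) = |c| * limNorm P θ x :=
  (preSpace_core P θ hP hθ).norm_smul c x

theorem mul_sum_limNorm_le_of_finset (hθ : ∀ n, θ n ∈ Set.Ioo (0 : ℝ) 1) (x : C00) (n : ℕ+)
    {ι : Type*} (s : Finset ι) (E : ι → Finset ℕ+) (q : ι → ℕ+)
    (hq : ∀ i ∈ s, q i ∈ E i ∧ ∀ a ∈ E i, q i ≤ a)
    (hd : ∀ i ∈ s, ∀ j ∈ s, i ≠ j → Disjoint (E i) (E j)) (hs : s.image q ∈ Schreier n) :
    θ n * ∑ i ∈ s, limNorm Allowable θ (restrict (E i) x) ≤ limNorm Allowable θ x := by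
  classical
  have hne : ∀ l, (E (s.equivFin.symm l)).Nonempty := fun l => ⟨_, (hq _ (Subtype.coe_prop _)).1⟩
  have := mul_sum_limNorm_le pairwiseDisj_allowable hθ x n s.card
    (fun l => E (s.equivFin.symm l)) ⟨?_, hne, ?_⟩
  · rw [Equiv.sum_comp s.equivFin.symm
      (fun i => limNorm Allowable θ (restrict (E (i : ι)) x))] at this
    rwa [← Finset.sum_coe_sort s]
  · intro i j hij
    refine hd _ (Subtype.coe_prop _) _ (Subtype.coe_prop _) fun h => hij ?_
    exact s.equivFin.symm.injective (Subtype.ext h)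
  · convert hs using 1
    ext a
    have hmin : ∀ l, (E (s.equivFin.symm l)).min' (hne l) = q (s.equivFin.symm l) := fun l =>
      le_antisymm (Finset.min'_le _ _ (hq _ (Subtype.coe_prop _)).1)
        ((hq _ (Subtype.coe_prop _)).2 _ (Finset.min'_mem _ _))
    simp only [Finset.mem_image, Finset.mem_univ, true_and, hmin]
    constructor
    · rintro ⟨l, rfl⟩
      exact ⟨_, Subtype.coe_prop _, rfl⟩
    · rintro ⟨i, hi, rfl⟩
      exact ⟨s.equivFin ⟨i, hi⟩, by simp⟩

end

theorem restrict_support_sum {w : ℕ → C00}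
    (hw : ∀ y z, y < z → Precedes (w y).support (w z).support) (a : ℕ → ℝ) {s : Finset ℕ} {z : ℕ}
    (hz : z ∈ s) : restrict (w z).support (∑ y ∈ s, a y • w y) = a z • w z := by
  ext k
  simp only [restrict, Finsupp.filter_apply, Finsupp.finsetSum_apply, Finsupp.smul_apply,
    smul_eq_mul]
  split_ifs with hk
  · refine Finset.sum_eq_single z (fun y _ hyz => ?_) fun h => absurd hz h
    have : k ∉ (w y).support := fun hy => by
      rcases lt_or_gt_of_ne hyz with h | h
      · exact lt_irrefl _ (hw y z h k hy k hk)
      · exact lt_irrefl _ (hw z y h k hk k hy)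
    rw [Finsupp.notMem_support_iff.1 this, mul_zero]
  · rw [Finsupp.notMem_support_iff.1 hk, mul_zero]

/-- In the modified space, the `R` levels of the test vector add up. -/
theorem le_limNorm_sum_coef {θ : ℕ+ → ℝ} (hθ : ∀ n, θ n ∈ Set.Ioo (0 : ℝ) 1) {ϑ c δ : ℝ}
    (hϑ : 0 < ϑ) (hcθ : ∀ n : ℕ+, c * ϑ ^ (n : ℕ) ≤ θ n) (hδ : 0 < δ) (hM : ∀ u, 0 < M u)
    (hMm : Monotone M) {w : ℕ → C00} (hw : ∀ y z, y < z → Precedes (w y).support (w z).support)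
    (hwδ : ∀ z, δ ≤ limNorm Allowable θ (w z)) (hwM : ∀ z, ∀ k ∈ (w z).support, M z ≤ (k : ℕ))
    {R u : ℕ} (hR : R ≤ M u) :
    θ 1 * (R * (c * δ)) ≤ limNorm Allowable θ
      (∑ z ∈ Finset.range (treeEnd M R u), coef ϑ M R u z • w z) := by
  classical
  set Z := ∑ z ∈ Finset.range (treeEnd M R u), coef ϑ M R u z • w z with hZ
  have hne : ∀ z, (w z).support.Nonempty := by
    intro z
    by_contra h
    rw [Finset.not_nonempty_iff_eq_empty, Finsupp.support_eq_empty] at h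
    have h1 := hwδ z
    have h2 := limNorm_smul pairwiseDisj_allowable hθ 0 (w z)
    rw [zero_smul, abs_zero, zero_mul] at h2
    rw [h, h2] at h1
    linarith
  have hdisj : ∀ y z, y ≠ z → Disjoint (w y).support (w z).support := by
    intro y z hyz
    rw [Finset.disjoint_left]
    intro k hy hz
    rcases lt_or_gt_of_ne hyz with h | h
    · exact lt_irrefl _ (hw y z h k hy k hz)
    · exact lt_irrefl _ (hw z y h k hz k hy)
  set q : ℕ → ℕ+ := fun z => (w z).support.min' (hne z) with hq
  have hqmem : ∀ z, q z ∈ (w z).support := fun z => Finset.min'_mem _ _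
  have hqmono : StrictMono q := fun y z h => hw y z h _ (hqmem y) _ (hqmem z)
  set S : ℕ → Finset ℕ+ := fun i => (levelSet M i R u).biUnion fun z => (w z).support with hS
  -- On level `i` the coefficients are at least `ϑ⁻ⁱ` times weights of total mass `1`; the supports
  -- of the `w z` form an `𝒮ᵢ`-allowable family, and `θᵢ ϑ⁻ⁱ ≥ c`.
  have hlevel : ∀ i, 1 ≤ i → i ≤ R → c * δ ≤ limNorm Allowable θ (restrict (S i) Z) := by
    intro i hi hiR
    set n : ℕ+ := ⟨i, hi⟩ with hn
    have h1 := mul_sum_limNorm_le_of_finset hθ (restrict (S i) Z) n (levelSet M i R u)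
      (fun z => (w z).support) q (fun z _ => ⟨hqmem z, fun a ha => Finset.min'_le _ _ ha⟩)
      (fun y _ z _ hyz => hdisj y z hyz)
      (image_levelSet_mem_schreier hqmono (fun z => hwM z _ (hqmem z)) i R u)
    refine le_trans ?_ h1
    have h2 : ∀ z ∈ levelSet M i R u, (ϑ ^ i)⁻¹ * mass M {z} i R u * δ ≤
        limNorm Allowable θ (restrict (w z).support (restrict (S i) Z)) := by
      intro z hz
      rw [restrict_restrict, Finset.inter_eq_left.2
        (Finset.subset_biUnion_of_mem (fun z => (w z).support) hz),
        hZ, restrict_support_sum hw _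
          (Finset.mem_range.2 (mem_Ico_of_mem_levelSet i R u z hz).2),
        limNorm_smul pairwiseDisj_allowable hθ, abs_of_nonneg (coef_nonneg hϑ _ _ _)]
      refine mul_le_mul ?_ (hwδ z) hδ.le (coef_nonneg hϑ _ _ _)
      exact Finset.single_le_sum (f := fun i => (ϑ ^ i)⁻¹ * mass M {z} i R u)
        (fun j _ => mul_nonneg (by positivity) (mass_nonneg _ _ _ _))
        (Finset.mem_range.2 (by omega))
    have h3 := Finset.sum_le_sum h2
    rw [← Finset.sum_mul, ← Finset.mul_sum, sum_levelSet_mass hM u hiR, mul_one] at h3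
    calc c * δ = c * ϑ ^ (n : ℕ) * ((ϑ ^ i)⁻¹ * δ) := by
          rw [hn, PNat.mk_coe]
          field_simp
      _ ≤ θ n * ((ϑ ^ i)⁻¹ * δ) := mul_le_mul_of_nonneg_right (hcθ n) (by positivity)
      _ ≤ _ := mul_le_mul_of_nonneg_left h3 (hθ n).1.le
  have hSne : ∀ i ∈ Finset.Icc 1 R, (S i).Nonempty := by
    intro i hi
    have hlev : (levelSet M i R u).Nonempty := by
      by_contra h
      rw [Finset.not_nonempty_iff_eq_empty] at h
      have := sum_levelSet_mass hM u (Finset.mem_Icc.1 hi).2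
      rw [h, Finset.sum_empty] at this
      exact zero_ne_one this
    obtain ⟨z, hz⟩ := hlev
    exact ⟨q z, Finset.mem_biUnion.2 ⟨z, hz, hqmem z⟩⟩
  set p : ℕ → ℕ+ := fun i => if h : (S i).Nonempty then (S i).min' h else 1 with hp
  have hpS : ∀ i ∈ Finset.Icc 1 R, p i ∈ S i ∧ ∀ a ∈ S i, p i ≤ a := by
    intro i hi
    simp only [hp]
    rw [dif_pos (hSne i hi)]
    exact ⟨Finset.min'_mem _ _, fun a ha => Finset.min'_le _ _ ha⟩
  -- The level supports are disjoint but need not be successive, so allowability is essential here.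
  -- Their `R` minima all lie above `M u ≥ R`, hence form a set of `𝒮₁`. The root level is left out.
  have h1 := mul_sum_limNorm_le_of_finset hθ Z 1 (Finset.Icc 1 R) S p hpS ?_ ?_
  · refine le_trans (mul_le_mul_of_nonneg_left ?_ (hθ 1).1.le) h1
    have := Finset.card_nsmul_le_sum (Finset.Icc 1 R)
      (fun i => limNorm Allowable θ (restrict (S i) Z)) (c * δ) fun i hi =>
        hlevel i (Finset.mem_Icc.1 hi).1 (Finset.mem_Icc.1 hi).2
    simpa using this
  · intro i _ j _ hij
    rw [Finset.disjoint_left]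
    intro k hk hk'
    obtain ⟨y, hy, hky⟩ := Finset.mem_biUnion.1 hk
    obtain ⟨z, hz, hkz⟩ := Finset.mem_biUnion.1 hk'
    have hyz : y = z := by
      by_contra h
      exact Finset.disjoint_left.1 (hdisj y z h) hky hkz
    exact hij (eq_of_mem_levelSet i j R u y hy (hyz ▸ hz))
  · refine mem_schreier_one_of_card_le fun a ha => ?_
    refine (Finset.card_image_le.trans (by simpa using hR)).trans ?_
    obtain ⟨i, hi, rfl⟩ := Finset.mem_image.1 ha
    obtain ⟨z, hz, hpz⟩ := Finset.mem_biUnion.1 (hpS i hi).1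
    exact (hMm (mem_Ico_of_mem_levelSet i R u z hz).1).trans (hwM z _ hpz)

end

/-! ### Gliding hump for operators between the completions. -/

section
variable {P : ℕ → ∀ r : ℕ, (Fin r → Finset ℕ+) → Prop} {θ : ℕ+ → ℝ}

/-- The embedding of `c₀₀` into the completion. -/
def embed (hP : PairwiseDisj P) (hθ : ∀ n, θ n ∈ Set.Ioo (0 : ℝ) 1) : C00 →ₗ[ℝ] UniformSpace.Completion (PreSpace P θ hP hθ) :=
  (UniformSpace.Completion.toComplₗᵢ (𝕜 := ℝ) (E := PreSpace P θ hP hθ)).toLinearMap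

theorem norm_embed (hP : PairwiseDisj P) (hθ : ∀ n, θ n ∈ Set.Ioo (0 : ℝ) 1)
    (x : C00) : ‖embed hP hθ x‖ = limNorm P θ x :=
  UniformSpace.Completion.norm_coe (E := PreSpace P θ hP hθ) x

theorem exists_norm_sub_embed_lt (hP : PairwiseDisj P) (hθ : ∀ n, θ n ∈ Set.Ioo (0 : ℝ) 1)
    (y : UniformSpace.Completion (PreSpace P θ hP hθ)) {ε : ℝ}
    (hε : 0 < ε) : ∃ x, ‖y - embed hP hθ x‖ < ε := by
  obtain ⟨x, hx⟩ := (UniformSpace.Completion.denseRange_coe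
    (α := PreSpace P θ hP hθ)).exists_dist_lt y hε
  exact ⟨x, by rw [← dist_eq_norm]; exact hx⟩

theorem abs_le_limNorm (hP : PairwiseDisj P) (hθ : ∀ n, θ n ∈ Set.Ioo (0 : ℝ) 1)
    (x : C00) (k : ℕ+) : |x k| ≤ limNorm P θ x :=
  (abs_le_iterNorm 0 x k).trans (le_ciSup (bddAbove_iterNorm hP hθ x) 0)

theorem limNorm_le_l1 (hP : PairwiseDisj P) (hθ : ∀ n, θ n ∈ Set.Ioo (0 : ℝ) 1)
    (x : C00) : limNorm P θ x ≤ l1 x :=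
  ciSup_le fun m => iterNorm_le_l1 hP hθ m x

theorem l1_restrict_le (E : Finset ℕ+) (x : C00) : l1 (restrict E x) ≤ ∑ k ∈ E, |x k| := by
  rw [l1_restrict, ← Finset.sum_filter]
  refine Finset.sum_le_sum_of_subset_of_nonneg (fun k hk => (Finset.mem_filter.1 hk).2)
    fun _ _ _ => abs_nonneg _

theorem limNorm_sub_le (hP : PairwiseDisj P) (hθ : ∀ n, θ n ∈ Set.Ioo (0 : ℝ) 1)
    (x y : C00) : limNorm P θ (x - y) ≤ limNorm P θ x + limNorm P θ y := by
  rw [← norm_embed hP hθ, ← norm_embed hP hθ, ← norm_embed hP hθ, map_sub]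
  exact norm_sub_le _ _

/-- A bounded sequence has a subsequence which is Cauchy on every finite set of coordinates. -/
theorem exists_subseq_limNorm_restrict_le (hP : PairwiseDisj P) (hθ : ∀ n, θ n ∈ Set.Ioo (0 : ℝ) 1)
    {v : ℕ → C00} {C : ℝ}
    (hv : ∀ k, limNorm P θ (v k) ≤ C) : ∃ φ : ℕ → ℕ, StrictMono φ ∧ ∀ (E : Finset ℕ+) (ε : ℝ),
      0 < ε → ∃ k₀, ∀ k ≥ k₀, ∀ l ≥ k₀, limNorm P θ (restrict E (v (φ k) - v (φ l))) ≤ ε := by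
  -- Coordinates are bounded by the norm, so the sequence lives in a compact countable product of
  -- intervals. On a finite set of coordinates the `ℓ¹`-norm controls the norm.
  have hc : IsCompact (Set.univ.pi fun _ : ℕ+ => Set.Icc (-C) C) :=
    isCompact_univ_pi fun _ => isCompact_Icc
  obtain ⟨y, -, φ, hφ, hlim⟩ := hc.tendsto_subseq (x := fun k n => v k n) fun k n _ =>
    abs_le.1 ((abs_le_limNorm hP hθ (v k) n).trans (hv k))
  refine ⟨φ, hφ, fun E ε hε => ?_⟩
  have h1 : Tendsto (fun k => ∑ n ∈ E, |v (φ k) n - y n|) atTop (𝓝 0) := by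
    have : Tendsto (fun k => ∑ n ∈ E, |v (φ k) n - y n|) atTop (𝓝 (∑ n ∈ E, |y n - y n|)) :=
      tendsto_finsetSum _ fun n _ =>
        ((tendsto_pi_nhds.1 hlim n).sub tendsto_const_nhds).abs
    simpa using this
  obtain ⟨k₀, hk₀⟩ := eventually_atTop.1 (h1.eventually_lt_const (half_pos hε))
  refine ⟨k₀, fun k hk l hl => ?_⟩
  refine (limNorm_le_l1 hP hθ _).trans ((l1_restrict_le _ _).trans ?_)
  have h2 : ∑ n ∈ E, |(v (φ k) - v (φ l)) n| ≤
      ∑ n ∈ E, |v (φ k) n - y n| + ∑ n ∈ E, |v (φ l) n - y n| := by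
    rw [← Finset.sum_add_distrib]
    refine Finset.sum_le_sum fun n _ => ?_
    rw [Finsupp.sub_apply, abs_sub_comm (v (φ l) n)]
    exact abs_sub_le _ _ _
  have h3 := hk₀ k hk
  have h4 := hk₀ l hl
  linarith

variable {Q : ℕ → ∀ r : ℕ, (Fin r → Finset ℕ+) → Prop}

theorem limNorm_single_le (hP : PairwiseDisj P) (hθ : ∀ n, θ n ∈ Set.Ioo (0 : ℝ) 1)
    (k : ℕ+) : limNorm P θ (Finsupp.single k 1) ≤ 1 := by
  refine (limNorm_le_l1 hP hθ _).trans ?_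
  rw [l1, Finsupp.support_single _ one_ne_zero]
  simp

/-- The images of suitable differences of unit vectors are close to vectors supported far out. -/
theorem exists_norm_map_sub_embed_le (hP : PairwiseDisj P)
    (hθ : ∀ n, θ n ∈ Set.Ioo (0 : ℝ) 1) (hQ : PairwiseDisj Q)
    (J : UniformSpace.Completion (PreSpace P θ hP hθ) →L[ℝ]
      UniformSpace.Completion (PreSpace Q θ hQ hθ)) (L : ℕ+) {ε : ℝ} (hε : 0 < ε) :
    ∃ (a b : ℕ+) (w : C00), L < a ∧ a < b ∧ (∀ k ∈ w.support, L < k) ∧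
      ‖J (embed hP hθ (Finsupp.single a 1 - Finsupp.single b 1)) - embed hQ hθ w‖ ≤ ε := by
  have hex : ∀ k : ℕ, ∃ x, ‖J (embed hP hθ (Finsupp.single k.succPNat 1)) - embed hQ hθ x‖ <
      (1 / 2 : ℝ) ^ k := fun k => exists_norm_sub_embed_lt hQ hθ _ (by positivity)
  choose v hv using hex
  have hbd : ∀ k, limNorm Q θ (v k) ≤ ‖J‖ + 1 := by
    intro k
    rw [← norm_embed hQ hθ]
    have h1 := J.le_opNorm (embed hP hθ (Finsupp.single k.succPNat 1))
    have h2 := limNorm_single_le hP hθ k.succPNat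
    rw [norm_embed] at h1
    have h3 := mul_le_mul_of_nonneg_left h2 (norm_nonneg J)
    have h4 : (1 / 2 : ℝ) ^ k ≤ 1 := pow_le_one₀ (by norm_num) (by norm_num)
    have h5 := norm_sub_norm_le (embed hQ hθ (v k))
      (J (embed hP hθ (Finsupp.single k.succPNat 1)))
    rw [norm_sub_rev] at h5
    have h6 := hv k
    linarith
  obtain ⟨φ, hφ, hsub⟩ := exists_subseq_limNorm_restrict_le hQ hθ hbd
  obtain ⟨k₀, hk₀⟩ := hsub (Finset.Icc 1 L) (ε / 3) (by positivity)
  obtain ⟨k₁, hk₁⟩ := exists_pow_lt_of_lt_one (show 0 < ε / 3 by positivity)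
    (show (1 / 2 : ℝ) < 1 by norm_num)
  set k := max (max k₀ k₁) L with hk
  have hpow : ∀ l, k ≤ l → (1 / 2 : ℝ) ^ φ l ≤ ε / 3 := fun l hl =>
    (pow_le_pow_of_le_one (by norm_num) (by norm_num)
      ((by omega : k₁ ≤ l).trans (hφ.le_apply))).trans hk₁.le
  set x := v (φ k) - v (φ (k + 1)) with hx
  refine ⟨(φ k).succPNat, (φ (k + 1)).succPNat, x - restrict (Finset.Icc 1 L) x, ?_, ?_, ?_, ?_⟩
  · have := hφ.le_apply (x := k)
    rw [← PNat.coe_lt_coe, Nat.succPNat_coe]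
    omega
  · exact Nat.succPNat_strictMono (hφ (Nat.lt_succ_self k))
  · intro n hn
    by_contra h
    rw [Finsupp.mem_support_iff] at hn
    apply hn
    rw [Finsupp.sub_apply, restrict, Finsupp.filter_apply, if_pos, sub_self]
    exact Finset.mem_Icc.2 ⟨one_le, not_lt.1 h⟩
  · have h1 := (hv (φ k)).le.trans (hpow k le_rfl)
    have h2 := (hv (φ (k + 1))).le.trans (hpow (k + 1) (Nat.le_succ k))
    have h3 := hk₀ k (by omega) (k + 1) (by omega)
    rw [← norm_embed hQ hθ] at h3
    have h4 : J (embed hP hθ (Finsupp.single (φ k).succPNat 1 -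
        Finsupp.single (φ (k + 1)).succPNat 1)) -
        embed hQ hθ (x - restrict (Finset.Icc 1 L) x) =
        (J (embed hP hθ (Finsupp.single (φ k).succPNat 1)) - embed hQ hθ (v (φ k))) -
        (J (embed hP hθ (Finsupp.single (φ (k + 1)).succPNat 1)) - embed hQ hθ (v (φ (k + 1)))) +
        embed hQ hθ (restrict (Finset.Icc 1 L) x) := by
      rw [map_sub, map_sub, map_sub, hx, map_sub]
      abel
    rw [h4]
    refine (norm_add_le _ _).trans ?_
    have := norm_sub_le
      (J (embed hP hθ (Finsupp.single (φ k).succPNat 1)) - embed hQ hθ (v (φ k)))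
      (J (embed hP hθ (Finsupp.single (φ (k + 1)).succPNat 1)) - embed hQ hθ (v (φ (k + 1))))
    linarith

/-- A gliding hump: sparse differences of unit vectors whose images are close to successive
vectors. -/
theorem exists_successive_approx (hP : PairwiseDisj P)
    (hθ : ∀ n, θ n ∈ Set.Ioo (0 : ℝ) 1) (hQ : PairwiseDisj Q)
    (J : UniformSpace.Completion (PreSpace P θ hP hθ) →L[ℝ]
      UniformSpace.Completion (PreSpace Q θ hQ hθ)) {ε : ℕ → ℝ} (hε : ∀ j, 0 < ε j) :
    ∃ (a b L : ℕ → ℕ+) (w : ℕ → C00), ∀ j, L j < a j ∧ a j < b j ∧ 4 * b j ≤ L (j + 1) ∧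
      (∀ k ∈ (w j).support, L j < k ∧ k ≤ L (j + 1)) ∧
      ‖J (embed hP hθ (Finsupp.single (a j) 1 - Finsupp.single (b j) 1)) - embed hQ hθ (w j)‖
        ≤ ε j := by
  choose a b w h1 h2 h3 h4 using fun (L : ℕ+) (j : ℕ) =>
    exists_norm_map_sub_embed_le hP hθ hQ J L (hε j)
  -- The next barrier lies beyond the current support and beyond four times the current indices,
  -- which provides the growth demanded of `M`.
  let L : ℕ → ℕ+ := fun j => Nat.rec 1 (fun j l => 4 * b l j + (w l j).support.sup id) j
  have hL : ∀ j, L (j + 1) = 4 * b (L j) j + (w (L j) j).support.sup id := fun _ => rfl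
  refine ⟨fun j => a (L j) j, fun j => b (L j) j, L, fun j => w (L j) j, fun j =>
    ⟨h1 _ _, h2 _ _, ?_, fun k hk => ⟨h3 _ _ k hk, ?_⟩, h4 _ _⟩⟩
  · rw [hL]
    exact (PNat.lt_add_right _ _).le
  · rw [hL]
    exact (Finset.le_sup (f := id) hk).trans (PNat.lt_add_left _ _).le

end

/-! ### Comparison of the two estimates. -/

theorem testVec_eq_sum_smul (ϑ : ℝ) (M : ℕ → ℕ) (K : ℕ → ℕ+) (R u : ℕ) :
    testVec ϑ M K R u =
      ∑ z ∈ Finset.range (treeEnd M R u), coef ϑ M R u z • Finsupp.single (K z) 1 := by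
  simp [testVec]

theorem sum_half_pow_le (n : ℕ) : ∑ j ∈ Finset.range n, (1 / 2 : ℝ) ^ j ≤ 2 := by
  exact (summable_geometric_two.sum_le_tsum _ fun _ _ => by positivity).trans_eq
    tsum_geometric_two

/-- Non-isomorphism from the two-sided estimate `c ϑⁿ ≤ θₙ ≤ d ϑⁿ` with `d < 1` alone: neither the
monotonicity nor the supermultiplicativity of `θ` plays a role. -/
theorem isEmpty_continuousLinearEquiv {θ : ℕ+ → ℝ} (hθ : ∀ n, θ n ∈ Set.Ioo (0 : ℝ) 1)
    {ϑ c d : ℝ} (hϑ : 0 < ϑ) (hϑ1 : ϑ < 1) (hc : 0 < c) (hd : 0 < d) (hd1 : d < 1)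
    (hcθ : ∀ n : ℕ+, c * ϑ ^ (n : ℕ) ≤ θ n) (hdθ : ∀ n : ℕ+, θ n ≤ d * ϑ ^ (n : ℕ)) :
    IsEmpty (T θ hθ ≃L[ℝ] TM θ hθ) := by
  refine ⟨fun J => ?_⟩
  have hP := pairwiseDisj_admissible
  have hQ := pairwiseDisj_allowable
  -- Differences of unit vectors have norm at least `1`, so their images have norm at least `2 * δ`;
  -- approximation within `δ` leaves at least `δ` for each `w z`.
  set δ : ℝ := (2 * (‖(J.symm : TM θ hθ →L[ℝ] T θ hθ)‖ + 1))⁻¹ with hδdef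
  have hδ : 0 < δ := by positivity
  obtain ⟨a, b, L, w, H⟩ := exists_successive_approx hP hθ hQ (J : T θ hθ →L[ℝ] TM θ hθ)
    (ε := fun j => δ * (1 / 2) ^ j) (fun j => by positivity)
  have hLa : ∀ j, L j < a j := fun j => (H j).1
  have hab : ∀ j, a j < b j := fun j => (H j).2.1
  have hbL : ∀ j, 4 * (b j : ℕ) ≤ L (j + 1) := fun j => by exact_mod_cast (H j).2.2.1
  have hLa' : ∀ j, (L j : ℕ) < a j := fun j => by exact_mod_cast hLa j
  have hab' : ∀ j, (a j : ℕ) < b j := fun j => by exact_mod_cast hab j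
  -- With the barriers as branching numbers, one tree fits the positions `a`, `b` and the supports
  -- of `w`.
  set M : ℕ → ℕ := fun j => L j with hMdef
  have hM : ∀ j, 0 < M j := fun j => (L j).pos
  have h4 : ∀ j, 4 * M j ≤ M (j + 1) := fun j => by
    have h1 := hbL j
    have h2 := hLa' j
    have h3 := hab' j
    simp only [hMdef]
    omega
  have hMa : ∀ j, 4 * (a j : ℕ) ≤ M (j + 1) := fun j => by
    have h1 := hbL j
    have h3 := hab' j
    simp only [hMdef]
    omega
  have hMm : Monotone M := monotone_of_four_mul_le h4
  have hLm : Monotone L := fun i j hij => by exact_mod_cast hMm hij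
  have ham : StrictMono a := strictMono_nat_of_lt_succ fun j => by
    rw [← PNat.coe_lt_coe]
    have h1 := hbL j
    have h2 := hLa' (j + 1)
    have h3 := hab' j
    omega
  have hbm : StrictMono b := strictMono_nat_of_lt_succ fun j => by
    rw [← PNat.coe_lt_coe]
    have h1 := hbL j
    have h2 := hLa' (j + 1)
    have h3 := hab' (j + 1)
    omega
  have hMtop : ∀ j, j ≤ M j := by
    intro j
    induction j with
    | zero => exact Nat.zero_le _
    | succ j ih =>
      have h1 := h4 j
      have h2 := hM j
      omega
  have hw : ∀ y z, y < z → Precedes (w y).support (w z).support := by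
    intro y z hyz k hk l hl
    exact (((H y).2.2.2.1 k hk).2.trans (hLm (Nat.succ_le_of_lt hyz))).trans_lt
      ((H z).2.2.2.1 l hl).1
  have happ : ∀ j, ‖J (embed hP hθ (Finsupp.single (a j) 1 - Finsupp.single (b j) 1)) -
      embed hQ hθ (w j)‖ ≤ δ * (1 / 2) ^ j := fun j => (H j).2.2.2.2
  have hwδ : ∀ z, δ ≤ limNorm Allowable θ (w z) := by
    intro z
    set e := embed hP hθ (Finsupp.single (a z) 1 - Finsupp.single (b z) 1) with he
    have h1 : 1 ≤ ‖e‖ := by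
      rw [he, norm_embed]
      refine le_trans ?_ (abs_le_limNorm hP hθ _ (a z))
      simp [(hab z).ne']
    have h2 : ‖e‖ ≤ ‖(J.symm : TM θ hθ →L[ℝ] T θ hθ)‖ * ‖J e‖ := by
      have := (J.symm : TM θ hθ →L[ℝ] T θ hθ).le_opNorm (J e)
      simpa using this
    have h3 : 2 * δ ≤ ‖J e‖ := by
      have h5 : 0 < ‖(J.symm : TM θ hθ →L[ℝ] T θ hθ)‖ + 1 := by positivity
      have h6 : 2 * δ = (‖(J.symm : TM θ hθ →L[ℝ] T θ hθ)‖ + 1)⁻¹ := by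
        rw [hδdef]; field_simp
      rw [h6, inv_le_iff_one_le_mul₀' h5]
      have := norm_nonneg (J e)
      linarith
    have h5 := happ z
    have h6 : (1 / 2 : ℝ) ^ z ≤ 1 := pow_le_one₀ (by norm_num) (by norm_num)
    have h7 := mul_le_mul_of_nonneg_left h6 hδ.le
    have h8 := norm_sub_norm_le (J e) (embed hQ hθ (w z))
    rw [norm_embed] at h8
    linarith
  -- The solution of `d * ((1 - ϑ)⁻¹ + β) = β`.
  set β : ℝ := d / (1 - d) * (1 - ϑ)⁻¹ with hβdef
  have hd' : 0 < 1 - d := by linarith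
  have hϑ' : 0 < 1 - ϑ := by linarith
  have hβ : 0 ≤ β := by positivity
  have hdβ : d * ((1 - ϑ)⁻¹ + β) ≤ β := by
    refine le_of_eq ?_
    rw [hβdef]
    field_simp
    ring
  -- The numerator is the bound for `‖J x‖` plus the total approximation error. It does not depend
  -- on `R`, whereas the lower bound is linear in `R`. The root `u` is chosen after `R`, far enough
  -- out for both estimates.
  obtain ⟨R, hR⟩ := exists_nat_gt
    ((‖(J : T θ hθ →L[ℝ] TM θ hθ)‖ * (2 * (2 + β)) + (2 + β) * (δ * 2)) / (θ 1 * (c * δ)))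
  rw [div_lt_iff₀ (mul_pos (hθ 1).1 (mul_pos hc hδ))] at hR
  obtain ⟨u', hu'⟩ := exists_nat_ge ((β + (ϑ ^ R)⁻¹) * (2 * (R + 1) ^ 2))
  set u := max R u' with hudef
  have hRu : R ≤ M u := (le_max_left _ _).trans (hMtop u)
  have hu : (β + (ϑ ^ R)⁻¹) * (2 * (R + 1) ^ 2) ≤ M u :=
    hu'.trans (by exact_mod_cast (le_max_right _ _).trans (hMtop u))
  have hTa := limNorm_testVec_le hϑ hϑ1 hd hd1 hβ hdβ hM h4 hMa ham hu hdθ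
  have hTb := limNorm_testVec_le hϑ hϑ1 hd hd1 hβ hdβ hM h4 hbL hbm hu hdθ
  have hlow := le_limNorm_sum_coef hθ hϑ hcθ hδ hM hMm hw hwδ
    (fun z k hk => by exact_mod_cast ((H z).2.2.2.1 k hk).1.le) hRu
  have hcoef : ∀ z, coef ϑ M R u z ≤ 2 + β := fun z => by
    rw [← testVec_apply ϑ ham.injective]
    exact (le_abs_self _).trans ((abs_le_limNorm hP hθ _ _).trans hTa)
  set Z := ∑ z ∈ Finset.range (treeEnd M R u), coef ϑ M R u z • w z with hZ
  set x := embed hP hθ (testVec ϑ M a R u - testVec ϑ M b R u) with hx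
  have hxnorm : ‖x‖ ≤ 2 * (2 + β) := by
    rw [hx, norm_embed]
    have := limNorm_sub_le hP hθ (testVec ϑ M a R u) (testVec ϑ M b R u)
    linarith
  have hJx : J x - embed hQ hθ Z = ∑ z ∈ Finset.range (treeEnd M R u), coef ϑ M R u z •
      (J (embed hP hθ (Finsupp.single (a z) 1 - Finsupp.single (b z) 1)) - embed hQ hθ (w z)) := by
    rw [hx, hZ, testVec_eq_sum_smul, testVec_eq_sum_smul, ← Finset.sum_sub_distrib]
    simp only [← smul_sub, map_sum, map_smul]
    rw [← Finset.sum_sub_distrib]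
    simp only [smul_sub]
  have herr : ‖J x - embed hQ hθ Z‖ ≤ (2 + β) * (δ * 2) := by
    rw [hJx]
    calc _ ≤ ∑ z ∈ Finset.range (treeEnd M R u), (2 + β) * (δ * (1 / 2) ^ z) := by
          refine norm_sum_le_of_le _ fun z _ => ?_
          rw [norm_smul, Real.norm_of_nonneg (coef_nonneg hϑ _ _ _)]
          exact mul_le_mul (hcoef z) (happ z) (norm_nonneg _) (by positivity)
      _ = (2 + β) * (δ * ∑ z ∈ Finset.range (treeEnd M R u), (1 / 2) ^ z) := by
          rw [Finset.mul_sum, Finset.mul_sum]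
      _ ≤ _ := by
          have := sum_half_pow_le (treeEnd M R u)
          gcongr
  have hJ := ((J : T θ hθ →L[ℝ] TM θ hθ).le_opNorm x).trans
    (mul_le_mul_of_nonneg_left hxnorm (norm_nonneg _))
  have htri := norm_sub_norm_le (embed hQ hθ Z) (J x)
  rw [norm_sub_rev, norm_embed] at htri
  have hJ' : ‖J x‖ ≤ ‖(J : T θ hθ →L[ℝ] TM θ hθ)‖ * (2 * (2 + β)) := hJ
  have : (R : ℝ) * (θ 1 * (c * δ)) = θ 1 * (R * (c * δ)) := by ring
  linarith

end MixedTsirelson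

end

/-- A mixed Tsirelson space `T[(𝒮ₙ, θₙ)]` and its modified version are not linearly homeomorphic
when `(θₙ)` is regular, `ϑ = lim θₙ^{1/n} < 1`, and `φₙ = θₙ / ϑⁿ` has `0 < inf φₙ ≤ sup φₙ < 1`. -/
theorem mainTheorem1 (θ : ℕ+ → ℝ) (hθ : ∀ n, θ n ∈ Set.Ioo (0 : ℝ) 1)
    (hnull : Filter.Tendsto θ Filter.atTop (nhds 0))
    (hreg : MixedTsirelson.IsRegular θ)
    (ϑ : ℝ)
    (hlim : Filter.Tendsto (fun n : ℕ+ => θ n ^ (1 / ((n : ℕ) : ℝ))) Filter.atTop (nhds ϑ))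
    (hlt : ϑ < 1)
    (c d : ℝ)
    (hc : IsGLB (Set.range fun n : ℕ+ => θ n / ϑ ^ (n : ℕ)) c) (hc0 : 0 < c)
    (hd : IsLUB (Set.range fun n : ℕ+ => θ n / ϑ ^ (n : ℕ)) d) (hd1 : d < 1) :
    ¬ Nonempty (MixedTsirelson.T θ hθ ≃L[ℝ] MixedTsirelson.TM θ hθ) := by
  have hc' : ∀ n : ℕ+, c ≤ θ n / ϑ ^ (n : ℕ) := fun n => hc.1 ⟨n, rfl⟩
  have hd' : ∀ n : ℕ+, θ n / ϑ ^ (n : ℕ) ≤ d := fun n => hd.1 ⟨n, rfl⟩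
  -- Positivity of `ϑ` follows from `θ 1 / ϑ ≥ c > 0`.
  have hϑ : 0 < ϑ := by
    have h := hc0.trans_le (hc' 1)
    rw [PNat.one_coe, pow_one] at h
    exact (div_pos_iff_of_pos_left (hθ 1).1).1 h
  rw [not_nonempty_iff]
  exact MixedTsirelson.isEmpty_continuousLinearEquiv hθ hϑ hlt hc0
    (hc0.trans_le ((hc' 1).trans (hd' 1))) hd1
    (fun n => (le_div_iff₀ (by positivity)).1 (hc' n))
    (fun n => (div_le_iff₀ (by positivity)).1 (hd' n))
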